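/- Let $M$ be a smooth manifold of dimension $2n+1$. An almost paracontact paracomplex Riemannian structure $(\phi,\xi,\eta,g)$ on $M$ consists of a smooth $(1,1)$-tensor field $\phi$, a smooth vector field $\xi$, a smooth $1$-form $\eta$ and a smooth Riemannian metric $g$ with $$\phi^2=\mathrm{id}-\eta\otimes\xi,\quad \eta(\xi)=1,\quad g(x,\xi)=\eta(x),\quad g(\phi x,\phi y)=g(x,y)-\eta(x)\eta(y),$$ such that the eigenspaces of $\phi$ on $H=\ker\eta$ for the eigenvalues $1$ and $-1$ both have dimension $n$. Let $\nabla$ be the Levi-Civita connection of $g$ and $F(x,y,z)=g((\nabla_x\phi)y,z)$. The structure is called para-Sasaki-like if for all $X,Y,Z\in H$ $$F(X,Y,Z)=F(\xi,Y,Z)=F(\xi,\xi,Z)=0,\qquad F(X,Y,\xi)=-g(X,Y).$$ With $R(x,y)z=\nabla_x\nabla_yz-\nabla_y\nabla_xz-\nabla_{[x,y]}z$ and a $g$-orthonormal basis $e_0,\dots,e_{2n}$ of the tangent space put $$Ric(x,y)=\sum_i g(R(e_i,x)y,e_i),\quad Scal=\sum_i Ric(e_i,e_i),\quad Scal^*=\sum_i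 Ric(e_i,\phi e_i).$$ For constants $u,v,w\in\mathbb R$, the paracontact homothetic transformation of $(\phi,\xi,\eta,g)$ is the almost paracontact paracomplex Riemannian structure $(\phi,\overline\xi,\overline\eta,\overline g)$ with $\overline\xi=e^{-w}\xi$, $\overline\eta=e^{w}\eta$ and $$\overline g(x,y)=e^{2u}\cosh(2v)\,g(x,y)+e^{2u}\sinh(2v)\,g(x,\phi y)+\{e^{2w}-e^{2u}\cosh(2v)\}\,\eta(x)\eta(y).$$ **Proposition.** Let $(M,\phi,\xi,\eta,g)$ be a para-Sasaki-like Riemannian manifold of dimension $2n+1$ and let $u,v,w$ be real constants. Then the Ricci tensor is invariant under the paracontact homothetic transformation, $$\overline{Ric}=Ric,$$ and the scalar curvature and the $*$-scalar curvature of the transformed structure are $$\overline{Scal}=e^{-2u}\cosh(2v)\,Scal-e^{-2u}\sinh(2v)\,Scal^*-2n\{e^{-2w}-e^{-2u}\cosh(2v)\},$$ $$\overline{Scal}^*=e^{-2u}\cosh(2v)\,Scal^*-e^{-2u}\sinh(2v)\,(Scal+2n).$$ -/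

import Mathlib

open Bundle VectorField Module
open scoped Manifold ContDiff

set_option linter.unusedSectionVars false

noncomputable section

namespace ParaSasaki

section LeviCivita

variable {E : Type*} [NormedAddCommGroup E] [NormedSpace ℝ E] [FiniteDimensional ℝ E]
  {H : Type*} [TopologicalSpace H] {I : ModelWithCorners ℝ E H}
  {M : Type*} [TopologicalSpace M] [ChartedSpace H M] [IsManifold I ∞ M]

/-- A smooth Riemannian metric on the manifold `M`. -/
abbrev SmoothRiemannianMetric (E : Type*) [NormedAddCommGroup E] [NormedSpace ℝ E]
    {H : Type*} [TopologicalSpace H] (I : ModelWithCorners ℝ E H)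
    (M : Type*) [TopologicalSpace M] [ChartedSpace H M] [IsManifold I ∞ M] : Type _ :=
  ContMDiffRiemannianMetric I ∞ E (TangentSpace I : M → Type _)

/-- `cov` is the Levi-Civita connection of `g`: it is torsion free and compatible with the metric.
In Mathlib's convention `cov Y p (X p)` is `(∇_X Y)(p)`. -/
structure IsLeviCivita (g : SmoothRiemannianMetric E I M)
    (cov : CovariantDerivative I E (TangentSpace I : M → Type _)) : Prop where
  torsion_free : ∀ {X Y : Π p : M, TangentSpace I p} {p : M}, MDiffAt (T% X) p → MDiffAt (T% Y) p →
    cov Y p (X p) - cov X p (Y p) = mlieBracket I X Y p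
  metric : ∀ {Y Z : Π p : M, TangentSpace I p} {p : M} (v : TangentSpace I p),
    MDiffAt (T% Y) p → MDiffAt (T% Z) p →
    mvfderiv I (fun q ↦ g.inner q (Y q) (Z q)) p v =
      g.inner p (cov Y p v) (Z p) + g.inner p (Y p) (cov Z p v)

theorem mdiffAt_inner (g : SmoothRiemannianMetric E I M) {X Y : Π p : M, TangentSpace I p} {p : M}
    (hX : MDiffAt (T% X) p) (hY : MDiffAt (T% Y) p) :
    MDiffAt (fun q ↦ g.inner q (X q) (Y q)) p := by
  have hg : MDifferentiableAt I (I.prod 𝓘(ℝ, E →L[ℝ] E →L[ℝ] ℝ))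
      (fun b ↦ TotalSpace.mk' (E →L[ℝ] E →L[ℝ] ℝ) b (g.inner b)) p :=
    g.contMDiff.mdifferentiableAt (by simp)
  have h := MDifferentiableAt.clm_bundle_apply₂ (F₁ := E) (F₂ := E) (F₃ := ℝ)
      (E₃ := Bundle.Trivial M ℝ) hg hX hY
  simp only [mdifferentiableAt_totalSpace] at h
  exact h.2

/-- The right-hand side of the Koszul formula for `2 g(∇_X Y, Z)`. -/
def koszul (g : SmoothRiemannianMetric E I M) (X Y Z : Π p : M, TangentSpace I p) (p : M) : ℝ :=
  mvfderiv I (fun q ↦ g.inner q (Y q) (Z q)) p (X p)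
    + mvfderiv I (fun q ↦ g.inner q (Z q) (X q)) p (Y p)
    - mvfderiv I (fun q ↦ g.inner q (X q) (Y q)) p (Z p)
    + g.inner p (mlieBracket I X Y p) (Z p) + g.inner p (mlieBracket I Z X p) (Y p)
    + g.inner p (mlieBracket I Z Y p) (X p)

theorem koszul_tensorial_left (g : SmoothRiemannianMetric E I M) {Y Z : Π p : M, TangentSpace I p} {p : M}
    (hY : MDiffAt (T% Y) p) (hZ : MDiffAt (T% Z) p) :
    TensorialAt I E (fun X ↦ koszul g X Y Z p) p where
  smul {f X} hf hX := by
    have h1 : (fun q ↦ g.inner q (Z q) ((f • X) q)) = f * fun q ↦ g.inner q (Z q) (X q) := by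
      ext q; simp
    have h2 : (fun q ↦ g.inner q ((f • X) q) (Y q)) = f * fun q ↦ g.inner q (X q) (Y q) := by
      ext q; simp
    simp only [koszul, h1, h2]
    rw [mvfderiv_mul hf (mdiffAt_inner g hZ hX), mvfderiv_mul hf (mdiffAt_inner g hX hY),
      mlieBracket_smul_left hf hX, mlieBracket_smul_right hf hX]
    simp
    linear_combination (mvfderiv I f p (Y p)) * g.symm p (Z p) (X p)
  add {X X'} hX hX' := by
    have h1 : (fun q ↦ g.inner q (Z q) ((X + X') q)) = (fun q ↦ g.inner q (Z q) (X q)) + fun q ↦ g.inner q (Z q) (X' q) := by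
      ext q; simp
    have h2 : (fun q ↦ g.inner q ((X + X') q) (Y q)) = (fun q ↦ g.inner q (X q) (Y q)) + fun q ↦ g.inner q (X' q) (Y q) := by
      ext q; simp
    simp only [koszul, h1, h2]
    rw [mvfderiv_add (mdiffAt_inner g hZ hX) (mdiffAt_inner g hZ hX'), mvfderiv_add (mdiffAt_inner g hX hY) (mdiffAt_inner g hX' hY),
      mlieBracket_add_left hX hX', mlieBracket_add_right hX hX']
    simp
    ring

theorem koszul_tensorial_right (g : SmoothRiemannianMetric E I M) {X Y : Π p : M, TangentSpace I p} {p : M}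
    (hX : MDiffAt (T% X) p) (hY : MDiffAt (T% Y) p) :
    TensorialAt I E (fun Z ↦ koszul g X Y Z p) p where
  smul {f Z} hf hZ := by
    have h1 : (fun q ↦ g.inner q ((f • Z) q) (X q)) = f * fun q ↦ g.inner q (Z q) (X q) := by
      ext q; simp
    have h2 : (fun q ↦ g.inner q (Y q) ((f • Z) q)) = f * fun q ↦ g.inner q (Y q) (Z q) := by
      ext q; simp
    simp only [koszul, h1, h2]
    rw [mvfderiv_mul hf (mdiffAt_inner g hZ hX), mvfderiv_mul hf (mdiffAt_inner g hY hZ),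
      mlieBracket_smul_left hf hZ, mlieBracket_smul_left hf hZ]
    simp
    linear_combination (mvfderiv I f p (X p)) * g.symm p (Y p) (Z p)
  add {Z Z'} hZ hZ' := by
    have h1 : (fun q ↦ g.inner q ((Z + Z') q) (X q)) = (fun q ↦ g.inner q (Z q) (X q)) + fun q ↦ g.inner q (Z' q) (X q) := by
      ext q; simp
    have h2 : (fun q ↦ g.inner q (Y q) ((Z + Z') q)) = (fun q ↦ g.inner q (Y q) (Z q)) + fun q ↦ g.inner q (Y q) (Z' q) := by
      ext q; simp
    simp only [koszul, h1, h2]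
    rw [mvfderiv_add (mdiffAt_inner g hZ hX) (mdiffAt_inner g hZ' hX), mvfderiv_add (mdiffAt_inner g hY hZ) (mdiffAt_inner g hY hZ'),
      mlieBracket_add_left hZ hZ', mlieBracket_add_left hZ hZ']
    simp
    ring

theorem koszul_smul_mid (g : SmoothRiemannianMetric E I M) {X Y Z : Π p : M, TangentSpace I p} {p : M} {f : M → ℝ}
    (hf : MDiffAt f p) (hX : MDiffAt (T% X) p) (hY : MDiffAt (T% Y) p) (hZ : MDiffAt (T% Z) p) :
    koszul g X (f • Y) Z p = f p * koszul g X Y Z p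
      + 2 * (mvfderiv I f p (X p) * g.inner p (Y p) (Z p)) := by
  have h1 : (fun q ↦ g.inner q ((f • Y) q) (Z q)) = f * fun q ↦ g.inner q (Y q) (Z q) := by
    ext q; simp
  have h2 : (fun q ↦ g.inner q (X q) ((f • Y) q)) = f * fun q ↦ g.inner q (X q) (Y q) := by
    ext q; simp
  simp only [koszul, h1, h2]
  rw [mvfderiv_mul hf (mdiffAt_inner g hY hZ), mvfderiv_mul hf (mdiffAt_inner g hX hY),
    mlieBracket_smul_right hf hY, mlieBracket_smul_right hf hY]
  simp
  linear_combination (mvfderiv I f p (Z p)) * g.symm p (Y p) (X p)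

theorem koszul_add_mid (g : SmoothRiemannianMetric E I M) {X Y Y' Z : Π p : M, TangentSpace I p} {p : M}
    (hX : MDiffAt (T% X) p) (hY : MDiffAt (T% Y) p) (hY' : MDiffAt (T% Y') p) (hZ : MDiffAt (T% Z) p) :
    koszul g X (Y + Y') Z p = koszul g X Y Z p + koszul g X Y' Z p := by
  have h1 : (fun q ↦ g.inner q ((Y + Y') q) (Z q)) = (fun q ↦ g.inner q (Y q) (Z q)) + fun q ↦ g.inner q (Y' q) (Z q) := by
    ext q; simp
  have h2 : (fun q ↦ g.inner q (X q) ((Y + Y') q)) = (fun q ↦ g.inner q (X q) (Y q)) + fun q ↦ g.inner q (X q) (Y' q) := by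
    ext q; simp
  simp only [koszul, h1, h2]
  rw [mvfderiv_add (mdiffAt_inner g hY hZ) (mdiffAt_inner g hY' hZ), mvfderiv_add (mdiffAt_inner g hX hY) (mdiffAt_inner g hX hY'),
    mlieBracket_add_right hY hY', mlieBracket_add_right hY hY']
  simp
  ring

theorem exists_musical (g : SmoothRiemannianMetric E I M) (p : M) :
    ∃ s : (TangentSpace I p →L[ℝ] ℝ) →L[ℝ] TangentSpace I p, ∀ l w, g.inner p (s l) w = l w := by
  have : FiniteDimensional ℝ (TangentSpace I p) := inferInstanceAs (FiniteDimensional ℝ E)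
  have : FiniteDimensional ℝ (TangentSpace I p →L[ℝ] ℝ) := inferInstanceAs (FiniteDimensional ℝ (E →L[ℝ] ℝ))
  let b : TangentSpace I p →ₗ[ℝ] TangentSpace I p →L[ℝ] ℝ := (g.inner p).toLinearMap
  have hb : Function.Injective b := by
    rw [← LinearMap.ker_eq_bot, LinearMap.ker_eq_bot']
    intro v hv
    by_contra h
    have h1 := g.pos p v h
    have h2 : g.inner p v v = 0 := congrArg (fun l : TangentSpace I p →L[ℝ] ℝ ↦ l v) hv
    exact absurd h2 h1.ne'
  have : T2Space (TangentSpace I p) := inferInstanceAs (T2Space E)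
  have : T2Space (TangentSpace I p →L[ℝ] ℝ) := inferInstanceAs (T2Space (E →L[ℝ] ℝ))
  have hd : finrank ℝ (TangentSpace I p) = finrank ℝ (TangentSpace I p →L[ℝ] ℝ) := by
    have h1 : finrank ℝ (TangentSpace I p →ₗ[ℝ] ℝ) = finrank ℝ (TangentSpace I p) :=
      Subspace.dual_finrank_eq
    rw [← h1]
    exact (LinearMap.toContinuousLinearMap : (TangentSpace I p →ₗ[ℝ] ℝ) ≃ₗ[ℝ] _).finrank_eq
  let e := LinearMap.linearEquivOfInjective b hb hd
  refine ⟨e.symm.toLinearMap.toContinuousLinearMap, fun l w ↦ ?_⟩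
  have : b (e.symm l) = l := e.apply_symm_apply l
  exact congrArg (fun l : TangentSpace I p →L[ℝ] ℝ ↦ l w) this

theorem metric_nondegenerate (g : SmoothRiemannianMetric E I M) {p : M} {v v' : TangentSpace I p}
    (h : ∀ w, g.inner p v w = g.inner p v' w) : v = v' := by
  by_contra hne
  have h1 := g.pos p (v - v') (sub_ne_zero.2 hne)
  have h2 : g.inner p (v - v') (v - v') = g.inner p v (v - v') - g.inner p v' (v - v') := by simp
  rw [h2, h, sub_self] at h1
  exact lt_irrefl _ h1

theorem exists_koszul_deriv (g : SmoothRiemannianMetric E I M) (Y : Π p : M, TangentSpace I p) (p : M) :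
    ∃ A : TangentSpace I p →L[ℝ] TangentSpace I p, MDiffAt (T% Y) p →
      ∀ X Z : Π q : M, TangentSpace I q, MDiffAt (T% X) p → MDiffAt (T% Z) p →
        2 * g.inner p (A (X p)) (Z p) = koszul g X Y Z p := by
  by_cases hY : MDiffAt (T% Y) p
  · obtain ⟨s, hs⟩ := exists_musical g p
    let B := TensorialAt.mkHom₂ (fun X Z ↦ koszul g X Y Z p) p
      (fun Z hZ ↦ koszul_tensorial_left g hY hZ) (fun X hX ↦ koszul_tensorial_right g hX hY)
    refine ⟨s ∘L ((2⁻¹ : ℝ) • B), fun _ X Z hX hZ ↦ ?_⟩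
    have h1 : B (X p) (Z p) = koszul g X Y Z p := TensorialAt.mkHom₂_apply _ _ hX hZ
    rw [ContinuousLinearMap.comp_apply, hs]
    simp [h1]
  · exact ⟨0, fun h ↦ absurd h hY⟩

theorem exists_isLeviCivita (g : SmoothRiemannianMetric E I M) :
    ∃ cov : CovariantDerivative I E (TangentSpace I : M → Type _), IsLeviCivita g cov := by
  choose A hA using exists_koszul_deriv g
  have key : ∀ {X Y : Π p : M, TangentSpace I p} {p : M}, MDiffAt (T% X) p → MDiffAt (T% Y) p → ∀ w, 
      2 * g.inner p (A Y p (X p)) w = koszul g X Y (FiberBundle.extend E w) p := by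
    intro X Y p hX hY w
    have := hA Y p hY X (FiberBundle.extend E w) hX (FiberBundle.mdifferentiableAt_extend ..)
    rwa [FiberBundle.extend_apply_self] at this
  refine ⟨⟨A, ?_, ?_⟩, ?_, ?_⟩
  · intro Y Y' p hY hY' _
    ext v
    refine metric_nondegenerate g fun w ↦ ?_
    have hv := FiberBundle.mdifferentiableAt_extend I E v
    have hw := FiberBundle.mdifferentiableAt_extend I E w
    have h1 := key hv hY w
    have h2 := key hv hY' w
    have h3 := key hv (mdifferentiableAt_add_section hY hY') w
    have h4 := koszul_add_mid g hv hY hY' hw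
    simp only [FiberBundle.extend_apply_self] at h1 h2 h3
    have h5 : g.inner p ((A Y p + A Y' p) v) w
        = g.inner p (A Y p v) w + g.inner p (A Y' p v) w := by simp
    rw [h5]
    linarith
  · intro Y f p hY hf _
    ext v
    refine metric_nondegenerate g fun w ↦ ?_
    have hv := FiberBundle.mdifferentiableAt_extend I E v
    have hw := FiberBundle.mdifferentiableAt_extend I E w
    have h1 := key hv hY w
    have h3 := key hv (hf.smul_section hY) w
    have h4 := koszul_smul_mid g hf hv hY hw
    simp only [FiberBundle.extend_apply_self] at h1 h3 h4
    have h5 : g.inner p ((f p • A Y p + (mvfderiv I f p).smulRight (Y p)) v) w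
        = f p * g.inner p (A Y p v) w + mvfderiv I f p v * g.inner p (Y p) w := by simp
    rw [h5]
    linear_combination (h3 + h4 + f p * (-h1)) / 2
  · intro X Y p hX hY
    refine metric_nondegenerate g fun w ↦ ?_
    have hw := FiberBundle.mdifferentiableAt_extend I E w
    have h1 := key hX hY w
    have h2 := key hY hX w
    have h3 : g.inner p (A Y p (X p) - A X p (Y p)) w
        = g.inner p (A Y p (X p)) w - g.inner p (A X p (Y p)) w := by simp
    have h4 : koszul g X Y (FiberBundle.extend E w) p - koszul g Y X (FiberBundle.extend E w) p
        = 2 * g.inner p (mlieBracket I X Y p) w := by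
      have h5 : g.inner p (mlieBracket I Y X p) w = - g.inner p (mlieBracket I X Y p) w := by
        rw [mlieBracket_swap_apply]; simp
      simp only [koszul, FiberBundle.extend_apply_self, h5,
        fun q ↦ g.symm q (FiberBundle.extend E w q) (X q),
        fun q ↦ g.symm q (FiberBundle.extend E w q) (Y q), fun q ↦ g.symm q (Y q) (X q)]
      ring
    change g.inner p (A Y p (X p) - A X p (Y p)) w = _
    rw [h3]
    linarith
  · intro Y Z p v hY hZ
    have hv := FiberBundle.mdifferentiableAt_extend I E v
    have h1 := hA Y p hY _ Z hv hZ
    have h2 := hA Z p hZ _ Y hv hY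
    simp only [FiberBundle.extend_apply_self] at h1 h2
    set X := FiberBundle.extend E v with hX
    have hXp : X p = v := FiberBundle.extend_apply_self ..
    have h4 : koszul g X Y Z p + koszul g X Z Y p
        = 2 * mvfderiv I (fun q ↦ g.inner q (Y q) (Z q)) p v := by
      have h5 : g.inner p (mlieBracket I Z X p) (Y p) = - g.inner p (mlieBracket I X Z p) (Y p) := by
        rw [mlieBracket_swap_apply]; simp
      have h6 : g.inner p (mlieBracket I Y X p) (Z p) = - g.inner p (mlieBracket I X Y p) (Z p) := by
        rw [mlieBracket_swap_apply]; simp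
      have h7 : g.inner p (mlieBracket I Z Y p) v = - g.inner p (mlieBracket I Y Z p) v := by
        rw [mlieBracket_swap_apply]; simp
      simp only [koszul, h5, h6, hXp, h7, fun q ↦ g.symm q (Z q) (X q),
        fun q ↦ g.symm q (Y q) (X q), fun q ↦ g.symm q (Z q) (Y q)]
      ring
    change _ = g.inner p (A Y p v) (Z p) + g.inner p (Y p) (A Z p v)
    rw [g.symm p (Y p)]
    linarith

/-- The Levi-Civita connection of the Riemannian metric `g`. -/
def leviCivita (g : SmoothRiemannianMetric E I M) :
    CovariantDerivative I E (TangentSpace I : M → Type _) :=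
  (exists_isLeviCivita g).choose

theorem isLeviCivita_leviCivita (g : SmoothRiemannianMetric E I M) :
    IsLeviCivita g (leviCivita g) :=
  (exists_isLeviCivita g).choose_spec

/-- The curvature tensor `R(x, y)z = ∇_x ∇_y z - ∇_y ∇_x z - ∇_[x, y] z` at `p`. The tangent vectors
are extended to vector fields which are smooth near `p`; by tensoriality the value does not depend
on the extension. -/
def curvature (g : SmoothRiemannianMetric E I M) (p : M) (x y z : TangentSpace I p) :
    TangentSpace I p :=
  let X : Π q : M, TangentSpace I q := FiberBundle.extend E x
  let Y : Π q : M, TangentSpace I q := FiberBundle.extend E y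
  let Z : Π q : M, TangentSpace I q := FiberBundle.extend E z
  leviCivita g (fun q ↦ leviCivita g Z q (Y q)) p (X p)
    - leviCivita g (fun q ↦ leviCivita g Z q (X q)) p (Y p)
    - leviCivita g Z p (mlieBracket I X Y p)

theorem exists_orthonormal_basis (g : SmoothRiemannianMetric E I M) (p : M) :
    ∃ e : Basis (Fin (finrank ℝ (TangentSpace I p))) ℝ (TangentSpace I p),
      ∀ i j, g.inner p (e i) (e j) = if i = j then 1 else 0 := by
  have : FiniteDimensional ℝ (TangentSpace I p) := inferInstanceAs (FiniteDimensional ℝ E)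
  let B : LinearMap.BilinForm ℝ (TangentSpace I p) :=
    LinearMap.mk₂ ℝ (fun v w ↦ g.inner p v w) (by simp) (by simp) (by simp) (by simp)
  have hB : LinearMap.IsSymm B := ⟨fun v w ↦ g.symm p v w⟩
  obtain ⟨f, hf⟩ := LinearMap.BilinForm.exists_orthogonal_basis hB
  have hpos : ∀ i, 0 < g.inner p (f i) (f i) := fun i ↦ g.pos p _ (f.ne_zero i)
  have hs : ∀ i, (Real.sqrt (g.inner p (f i) (f i)))⁻¹ ≠ 0 :=
    fun i ↦ inv_ne_zero (Real.sqrt_pos.2 (hpos i)).ne'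
  refine ⟨f.unitsSMul fun i ↦ Units.mk0 _ (hs i), fun i j ↦ ?_⟩
  rw [Basis.unitsSMul_apply, Basis.unitsSMul_apply]
  simp only [Units.smul_def, Units.val_mk0, map_smul, smul_apply, smul_eq_mul]
  split_ifs with h
  · subst h
    have h1 := Real.mul_self_sqrt (hpos i).le
    have h2 := (Real.sqrt_pos.2 (hpos i)).ne'
    field_simp
    rw [sq, h1]
  · have h1 : g.inner p (f i) (f j) = 0 := hf h
    simp [h1]

theorem contMDiff_bilin {B : Π p : M, TangentSpace I p →L[ℝ] TangentSpace I p →L[ℝ] ℝ}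
    (hB : ∀ (p : M) (v w : TangentSpace I p), ContMDiffAt I 𝓘(ℝ) ∞
      (fun q ↦ B q (FiberBundle.extend E v q) (FiberBundle.extend E w q)) p) :
    ContMDiff I (I.prod 𝓘(ℝ, E →L[ℝ] E →L[ℝ] ℝ)) ∞
      (fun b ↦ TotalSpace.mk' (E →L[ℝ] E →L[ℝ] ℝ) b (B b)) := by
  intro p
  rw [contMDiffAt_hom_bundle]
  refine ⟨contMDiffAt_id, ?_⟩
  let t := trivializationAt E (TangentSpace I : M → Type _) p
  have hp : p ∈ t.baseSet := FiberBundle.mem_baseSet_trivializationAt' p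
  let C : M → E →L[ℝ] E →L[ℝ] ℝ := fun x ↦ ContinuousLinearMap.inCoordinates E (TangentSpace I) (E →L[ℝ] ℝ) (fun x ↦ TangentSpace I x →L[ℝ] ℝ) p x p x (B x)
  have hC : ∀ x ∈ t.baseSet, ∀ a b, C x a b = B x (t.symm x a) (t.symm x b) := by
    intro x hx a b
    exact (inCoordinates_apply_eq₂ (𝕜 := ℝ) (F₃ := ℝ) (E₃ := Bundle.Trivial M ℝ) (ϕ := B x)
      hx hx (Set.mem_univ _)).trans (by simp [t])
  have hCs : ∀ a b, ContMDiffAt I 𝓘(ℝ) ∞ (fun x ↦ C x a b) p := by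
    intro a b
    refine (hB p (t.symm p a) (t.symm p b)).congr_of_eventuallyEq ?_
    filter_upwards [t.open_baseSet.mem_nhds hp] with x hx
    rw [hC x hx]
    have h1 : ∀ c : E, (t ⟨p, t.symm p c⟩).2 = c := fun c ↦ by rw [t.apply_mk_symm hp]
    change _ = B x (t.symm x (t ⟨p, t.symm p a⟩).2) (t.symm x (t ⟨p, t.symm p b⟩).2)
    rw [h1, h1]
  let e := Module.finBasis ℝ E
  have h2 : C = fun x ↦ ∑ i, ∑ j, C x (e i) (e j) • 
      ((e.coord i).toContinuousLinearMap.smulRight (e.coord j).toContinuousLinearMap : E →L[ℝ] E →L[ℝ] ℝ) := by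
    ext x a b
    conv_lhs => rw [← e.sum_repr a, ← e.sum_repr b]
    simp only [map_sum, map_smul, sum_apply, smul_apply, Finset.smul_sum]
    rw [Finset.sum_comm]
    refine Finset.sum_congr rfl fun i _ ↦ Finset.sum_congr rfl fun j _ ↦ ?_
    simp
    ring
  change ContMDiffAt I _ ∞ C p
  rw [h2]
  refine contMDiffAt_finsetSum fun i _ ↦ contMDiffAt_finsetSum fun j _ ↦ ?_
  exact (hCs _ _).smul contMDiffAt_const

theorem isVonNBounded_of_pos {p : M} (B : TangentSpace I p →L[ℝ] TangentSpace I p →L[ℝ] ℝ)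
    (hB : ∀ v, v ≠ 0 → 0 < B v v) : Bornology.IsVonNBounded ℝ {v | B v v < 1} := by
  change E →L[ℝ] E →L[ℝ] ℝ at B
  change Bornology.IsVonNBounded ℝ {v : E | B v v < 1}
  change ∀ v : E, v ≠ 0 → 0 < B v v at hB
  rw [NormedSpace.isVonNBounded_iff]
  rcases subsingleton_or_nontrivial E with h | h
  · exact (Set.toFinite _).isBounded
  have hc : IsCompact (Metric.sphere (0 : E) 1) := isCompact_sphere 0 1
  obtain ⟨x, hx, hmin⟩ := hc.exists_isMinOn (NormedSpace.sphere_nonempty.2 zero_le_one)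
    (f := fun v ↦ B v v) ((B.continuous.clm_apply continuous_id).continuousOn)
  have hx1 : ‖x‖ = 1 := by simpa using hx
  have hpos : 0 < B x x := hB x (by rintro rfl; simp at hx1)
  have hle : ∀ v : E, ‖v‖ ^ 2 * B x x ≤ B v v := by
    intro v
    by_cases hv : v = 0
    · simp [hv]
    have hn : 0 < ‖v‖ := norm_pos_iff.2 hv
    have h1 : B x x ≤ B (‖v‖⁻¹ • v) (‖v‖⁻¹ • v) := hmin (show ‖v‖⁻¹ • v ∈ Metric.sphere (0 : E) 1 by
      simp [norm_smul, inv_mul_cancel₀ hn.ne'])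
    simp only [map_smul, smul_apply, smul_eq_mul] at h1
    calc ‖v‖ ^ 2 * B x x ≤ ‖v‖ ^ 2 * (‖v‖⁻¹ * (‖v‖⁻¹ * B v v)) := by gcongr
      _ = B v v := by field_simp
  refine (Metric.isBounded_closedBall (x := (0 : E)) (r := (B x x)⁻¹ + 1)).subset fun v hv ↦ ?_
  rw [mem_closedBall_zero_iff]
  have h2 : ‖v‖ ^ 2 * B x x ≤ 1 := (hle v).trans (le_of_lt hv)
  have h3 : ‖v‖ ^ 2 ≤ (B x x)⁻¹ := by rw [← one_div, le_div_iff₀ hpos]; exact h2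
  nlinarith [sq_nonneg (‖v‖ - 1), inv_pos.2 hpos]

/-- A `g`-orthonormal basis of the tangent space at `p`. -/
def orthonormalBasis (g : SmoothRiemannianMetric E I M) (p : M) :
    Basis (Fin (finrank ℝ (TangentSpace I p))) ℝ (TangentSpace I p) :=
  (exists_orthonormal_basis g p).choose

theorem orthonormalBasis_inner (g : SmoothRiemannianMetric E I M) (p : M)
    (i j : Fin (finrank ℝ (TangentSpace I p))) :
    g.inner p (orthonormalBasis g p i) (orthonormalBasis g p j) = if i = j then 1 else 0 :=
  (exists_orthonormal_basis g p).choose_spec i j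

/-- The Ricci tensor `Ric(x, y) = ∑ᵢ g(R(eᵢ, x)y, eᵢ)`. -/
def ricci (g : SmoothRiemannianMetric E I M) (p : M) (x y : TangentSpace I p) : ℝ :=
  ∑ i, g.inner p (curvature g p (orthonormalBasis g p i) x y) (orthonormalBasis g p i)

/-- The scalar curvature `Scal = ∑ᵢ Ric(eᵢ, eᵢ)`. -/
def scal (g : SmoothRiemannianMetric E I M) (p : M) : ℝ :=
  ∑ i, ricci g p (orthonormalBasis g p i) (orthonormalBasis g p i)

end LeviCivita

/-- An almost paracontact paracomplex Riemannian structure `(φ, ξ, η, g)` on a `(2n+1)`-dimensional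
smooth manifold `M`: the two eigenspaces of `φ` on the paracontact distribution `ker η`, for the
eigenvalues `1` and `-1`, have the same dimension `n`. -/
structure AlmostParacontactParacomplexRiemannian (n : ℕ) (M : Type*) [TopologicalSpace M]
    [ChartedSpace (EuclideanSpace ℝ (Fin (2 * n + 1))) M] [IsManifold (𝓡 (2 * n + 1)) ∞ M] where
  phi : Π p : M, TangentSpace (𝓡 (2 * n + 1)) p →L[ℝ] TangentSpace (𝓡 (2 * n + 1)) p
  xi : Π p : M, TangentSpace (𝓡 (2 * n + 1)) p
  eta : Π p : M, TangentSpace (𝓡 (2 * n + 1)) p →L[ℝ] ℝ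
  g : SmoothRiemannianMetric (EuclideanSpace ℝ (Fin (2 * n + 1))) (𝓡 (2 * n + 1)) M
  contMDiff_phi : ContMDiff (𝓡 (2 * n + 1))
    ((𝓡 (2 * n + 1)).prod
      𝓘(ℝ, EuclideanSpace ℝ (Fin (2 * n + 1)) →L[ℝ] EuclideanSpace ℝ (Fin (2 * n + 1)))) ∞
    (fun p ↦ TotalSpace.mk' (EuclideanSpace ℝ (Fin (2 * n + 1)) →L[ℝ] EuclideanSpace ℝ (Fin (2 * n + 1)))
      (E := fun p : M ↦ TangentSpace (𝓡 (2 * n + 1)) p →L[ℝ] TangentSpace (𝓡 (2 * n + 1)) p) p (phi p))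
  contMDiff_xi : ContMDiff (𝓡 (2 * n + 1))
    ((𝓡 (2 * n + 1)).prod 𝓘(ℝ, EuclideanSpace ℝ (Fin (2 * n + 1)))) ∞
    (fun p ↦ TotalSpace.mk' (EuclideanSpace ℝ (Fin (2 * n + 1)))
      (E := (TangentSpace (𝓡 (2 * n + 1)) : M → Type _)) p (xi p))
  contMDiff_eta : ContMDiff (𝓡 (2 * n + 1))
    ((𝓡 (2 * n + 1)).prod 𝓘(ℝ, EuclideanSpace ℝ (Fin (2 * n + 1)) →L[ℝ] ℝ)) ∞
    (fun p ↦ TotalSpace.mk' (EuclideanSpace ℝ (Fin (2 * n + 1)) →L[ℝ] ℝ)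
      (E := fun p : M ↦ TangentSpace (𝓡 (2 * n + 1)) p →L[ℝ] Bundle.Trivial M ℝ p) p (eta p))
  phi_phi : ∀ p v, phi p (phi p v) = v - eta p v • xi p
  eta_xi : ∀ p, eta p (xi p) = 1
  finrank_pos : ∀ p, finrank ℝ
    ↥(Module.End.eigenspace (phi p).toLinearMap 1 ⊓ LinearMap.ker (eta p).toLinearMap) = n
  finrank_neg : ∀ p, finrank ℝ
    ↥(Module.End.eigenspace (phi p).toLinearMap (-1) ⊓ LinearMap.ker (eta p).toLinearMap) = n
  g_xi : ∀ p v, g.inner p v (xi p) = eta p v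
  g_phi_phi : ∀ p v w, g.inner p (phi p v) (phi p w) = g.inner p v w - eta p v * eta p w

namespace AlmostParacontactParacomplexRiemannian

variable {n : ℕ} {M : Type*} [TopologicalSpace M]
  [ChartedSpace (EuclideanSpace ℝ (Fin (2 * n + 1))) M] [IsManifold (𝓡 (2 * n + 1)) ∞ M]
  (S : AlmostParacontactParacomplexRiemannian n M)

theorem phi_xi (p : M) : S.phi p (S.xi p) = 0 := by
  have h0 : S.phi p (S.phi p (S.xi p)) = 0 := by rw [S.phi_phi, S.eta_xi]; simp
  have h1 := S.phi_phi p (S.phi p (S.xi p))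
  rw [h0, map_zero] at h1
  have h2 : S.phi p (S.xi p) = S.eta p (S.phi p (S.xi p)) • S.xi p := (sub_eq_zero.1 h1.symm)
  rw [h2, map_smul, smul_eq_zero] at h0
  rcases h0 with h | h
  · rw [h2, h, zero_smul]
  · exact h

theorem eta_phi (p : M) (v : TangentSpace (𝓡 (2 * n + 1)) p) : S.eta p (S.phi p v) = 0 := by
  rw [← S.g_xi]
  have h := S.g_phi_phi p (S.phi p v) (S.xi p)
  rw [S.phi_xi, map_zero, S.g_xi, S.eta_xi, mul_one, sub_self] at h
  have h1 := S.phi_phi p (S.phi p v)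
  rw [S.phi_phi p v, map_sub, map_smul, S.phi_xi, smul_zero, sub_zero] at h1
  have h2 : S.eta p (S.phi p v) • S.xi p = 0 := sub_eq_self.1 h1.symm
  rw [S.g_xi]
  have h3 := congrArg (S.eta p) h2
  simpa [S.eta_xi] using h3

theorem g_phi_symm (p : M) (v w : TangentSpace (𝓡 (2 * n + 1)) p) :
    S.g.inner p v (S.phi p w) = S.g.inner p w (S.phi p v) := by
  have h := S.g_phi_phi p v (S.phi p w)
  rw [S.phi_phi, S.eta_phi, map_sub, map_smul, S.g_xi, S.eta_phi] at h
  simp only [smul_eq_mul, mul_zero, sub_zero] at h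
  rw [← h, S.g.symm]

/-- The bilinear form
`e^{2u} cosh(2v) g(x, y) + e^{2u} sinh(2v) g(x, φ y) + (e^{2w} - e^{2u} cosh(2v)) η(x) η(y)`
with constants `u`, `v`, `w`. -/
def homotheticForm (u v w : ℝ) (p : M) : TangentSpace (𝓡 (2 * n + 1)) p →L[ℝ]
    TangentSpace (𝓡 (2 * n + 1)) p →L[ℝ] ℝ :=
  (Real.exp (2 * u) * Real.cosh (2 * v)) • S.g.inner p
    + (Real.exp (2 * u) * Real.sinh (2 * v)) • (S.g.inner p ∘L S.phi p)
    + (Real.exp (2 * w) - Real.exp (2 * u) * Real.cosh (2 * v)) •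
      (S.eta p).smulRight (S.eta p)

theorem homotheticForm_apply (u v w : ℝ) (p : M) (x y : TangentSpace (𝓡 (2 * n + 1)) p) :
    S.homotheticForm u v w p x y =
      Real.exp (2 * u) * Real.cosh (2 * v) * S.g.inner p x y
        + Real.exp (2 * u) * Real.sinh (2 * v) * S.g.inner p x (S.phi p y)
        + (Real.exp (2 * w) - Real.exp (2 * u) * Real.cosh (2 * v)) * (S.eta p x * S.eta p y) := by
  have h := S.g_phi_symm p x y
  rw [h, S.g.symm p y]
  simp [homotheticForm]

theorem homotheticForm_symm (u v w : ℝ) (p : M) (x y : TangentSpace (𝓡 (2 * n + 1)) p) :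
    S.homotheticForm u v w p x y = S.homotheticForm u v w p y x := by
  rw [homotheticForm_apply, homotheticForm_apply, S.g.symm p x y, S.g_phi_symm p x y]
  ring

theorem homothetic_pos_aux (u v w G e a : ℝ) (hG : 0 < G) (p1 : 0 ≤ G - e ^ 2 + a)
    (p2 : 0 ≤ G - e ^ 2 - a) :
    0 < Real.exp (2 * u) * Real.cosh (2 * v) * G + Real.exp (2 * u) * Real.sinh (2 * v) * a
      + (Real.exp (2 * w) - Real.exp (2 * u) * Real.cosh (2 * v)) * (e * e) := by
  have hE : Real.exp (2 * u) * Real.cosh (2 * v) * G + Real.exp (2 * u) * Real.sinh (2 * v) * a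
      + (Real.exp (2 * w) - Real.exp (2 * u) * Real.cosh (2 * v)) * (e * e)
      = Real.exp (2 * w) * e ^ 2 + Real.exp (2 * u) / 2 *
        (Real.exp (2 * v) * (G - e ^ 2 + a) + Real.exp (-(2 * v)) * (G - e ^ 2 - a)) := by
    rw [Real.cosh_eq, Real.sinh_eq]
    ring
  rw [hE]
  have e1 := Real.exp_pos (2 * w)
  have e2 := Real.exp_pos (2 * u)
  have e3 := Real.exp_pos (2 * v)
  have e4 := Real.exp_pos (-(2 * v))
  have q1 := mul_nonneg e3.le p1
  have q2 := mul_nonneg e4.le p2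
  rcases eq_or_ne e 0 with rfl | he
  · have : 0 < Real.exp (2 * v) * (G - 0 ^ 2 + a) + Real.exp (-(2 * v)) * (G - 0 ^ 2 - a) := by
      rcases p1.lt_or_eq with h | h
      · have := mul_pos e3 h
        linarith
      · have := mul_pos e4 (show 0 < G - 0 ^ 2 - a by linarith)
        linarith
    have := mul_pos (half_pos e2) this
    linarith
  · have : 0 < Real.exp (2 * w) * e ^ 2 := by positivity
    have := mul_nonneg (half_pos e2).le (add_nonneg q1 q2)
    linarith

theorem homotheticForm_pos (u v w : ℝ) (p : M) (x : TangentSpace (𝓡 (2 * n + 1)) p) (hx : x ≠ 0) :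
    0 < S.homotheticForm u v w p x x := by
  set a := S.phi p x
  have h1 : S.g.inner p a a = S.g.inner p x x - S.eta p x * S.eta p x := S.g_phi_phi p x x
  have hxi : S.g.inner p (S.xi p) (S.xi p) = 1 := by rw [S.g_xi, S.eta_xi]
  have nn : ∀ y : TangentSpace (𝓡 (2 * n + 1)) p, 0 ≤ S.g.inner p y y := by
    intro y
    rcases eq_or_ne y 0 with rfl | h
    · simp
    · exact (S.g.pos p y h).le
  have hs : S.g.inner p a x = S.g.inner p x a := S.g.symm p a x
  have hxiφ : S.g.inner p a (S.xi p) = 0 := by rw [S.g_xi, S.eta_phi]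
  have hxiφ' : S.g.inner p (S.xi p) a = 0 := by rw [S.g.symm, hxiφ]
  have hxx : S.g.inner p x (S.xi p) = S.eta p x := S.g_xi p x
  have hxx' : S.g.inner p (S.xi p) x = S.eta p x := by rw [S.g.symm, hxx]
  have hp : S.g.inner p (x - S.eta p x • S.xi p + a) (x - S.eta p x • S.xi p + a)
      = 2 * (S.g.inner p x x - S.eta p x ^ 2 + S.g.inner p x a) := by
    simp only [map_add, map_sub, map_smul, add_apply, sub_apply, smul_apply, smul_eq_mul, h1, hs,
      hxi, hxiφ, hxiφ', hxx, hxx']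
    ring
  have hm : S.g.inner p (x - S.eta p x • S.xi p - a) (x - S.eta p x • S.xi p - a)
      = 2 * (S.g.inner p x x - S.eta p x ^ 2 - S.g.inner p x a) := by
    simp only [map_sub, map_smul, sub_apply, smul_apply, smul_eq_mul, h1, hs,
      hxi, hxiφ, hxiφ', hxx, hxx']
    ring
  have p1 : 0 ≤ S.g.inner p x x - S.eta p x ^ 2 + S.g.inner p x a := by
    have := nn (x - S.eta p x • S.xi p + a)
    rw [hp] at this; linarith
  have p2 : 0 ≤ S.g.inner p x x - S.eta p x ^ 2 - S.g.inner p x a := by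
    have := nn (x - S.eta p x • S.xi p - a)
    rw [hm] at this; linarith
  rw [homotheticForm_apply]
  exact homothetic_pos_aux u v w _ _ _ (S.g.pos p x hx) p1 p2

theorem homotheticForm_contMDiff (u v w : ℝ) :
    ContMDiff (𝓡 (2 * n + 1)) ((𝓡 (2 * n + 1)).prod
      𝓘(ℝ, EuclideanSpace ℝ (Fin (2 * n + 1)) →L[ℝ] EuclideanSpace ℝ (Fin (2 * n + 1)) →L[ℝ] ℝ)) ∞
      (fun p : M ↦ TotalSpace.mk'
        (EuclideanSpace ℝ (Fin (2 * n + 1)) →L[ℝ] EuclideanSpace ℝ (Fin (2 * n + 1)) →L[ℝ] ℝ) p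
        (S.homotheticForm u v w p)) := by
  apply contMDiff_bilin
  intro p a b
  have ha := FiberBundle.contMDiffAt_extend (k := ∞) (𝓡 (2 * n + 1)) (EuclideanSpace ℝ (Fin (2 * n + 1))) a
  have hb := FiberBundle.contMDiffAt_extend (k := ∞) (𝓡 (2 * n + 1)) (EuclideanSpace ℝ (Fin (2 * n + 1))) b
  have hphi := (S.contMDiff_phi p).clm_bundle_apply hb
  have h1 := (S.contMDiff_eta p).clm_bundle_apply ha
  have h2 := (S.contMDiff_eta p).clm_bundle_apply hb
  have h3 := ContMDiffAt.clm_bundle_apply₂ (F₃ := ℝ) (E₃ := Bundle.Trivial M ℝ)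
    S.g.contMDiff.contMDiffAt ha hb
  have h4 := ContMDiffAt.clm_bundle_apply₂ (F₃ := ℝ) (E₃ := Bundle.Trivial M ℝ)
    S.g.contMDiff.contMDiffAt ha hphi
  rw [contMDiffAt_totalSpace] at h1 h2 h3 h4
  simp only [homotheticForm_apply]
  exact ((contMDiffAt_const.mul h3.2).add (contMDiffAt_const.mul h4.2)).add
    (contMDiffAt_const.mul (h1.2.mul h2.2))

/-- The paracontact homothetic transformation of `(φ, ξ, η, g)` with constants `u`, `v`, `w`: the
structure `(φ, e^{-w} ξ, e^w η, g')`, with `g'` the form `homotheticForm u v w`. -/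
def paracontactHomothety (u v w : ℝ) : AlmostParacontactParacomplexRiemannian n M where
  phi := S.phi
  xi p := Real.exp (-w) • S.xi p
  eta p := Real.exp w • S.eta p
  g :=
    { inner := S.homotheticForm u v w
      symm := S.homotheticForm_symm u v w
      pos := S.homotheticForm_pos u v w
      isVonNBounded := fun p ↦ isVonNBounded_of_pos _ (S.homotheticForm_pos u v w p)
      contMDiff := S.homotheticForm_contMDiff u v w }
  contMDiff_phi := S.contMDiff_phi
  contMDiff_xi := S.contMDiff_xi.const_smul_section
  contMDiff_eta := ContMDiff.const_smul_section (a := Real.exp w) S.contMDiff_eta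
  phi_phi p x := by
    rw [S.phi_phi, smul_apply, smul_smul, smul_eq_mul, mul_right_comm, ← Real.exp_add]
    simp
  eta_xi p := by
    simp [S.eta_xi, ← Real.exp_add]
  finrank_pos p := by
    have h : LinearMap.ker (Real.exp w • S.eta p).toLinearMap
        = LinearMap.ker (S.eta p).toLinearMap := by
      ext x; simp
    rw [h, S.finrank_pos]
  finrank_neg p := by
    have h : LinearMap.ker (Real.exp w • S.eta p).toLinearMap
        = LinearMap.ker (S.eta p).toLinearMap := by
      ext x; simp
    rw [h, S.finrank_neg]
  g_xi p x := by
    rw [S.homotheticForm_apply, map_smul, map_smul, map_smul, map_smul, S.phi_xi, S.g_xi, S.eta_xi]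
    have h : Real.exp (2 * w) = Real.exp w * Real.exp w := by rw [← Real.exp_add]; ring_nf
    have h' : Real.exp (-w) * Real.exp w = 1 := by rw [← Real.exp_add]; simp
    simp [h]
    linear_combination (S.eta p x * Real.exp w) * h'
  g_phi_phi p x y := by
    rw [S.homotheticForm_apply, S.homotheticForm_apply, S.phi_phi, S.g_phi_phi, S.eta_phi, map_sub,
      map_smul, S.g_xi, S.eta_phi, S.g.symm p _ y, S.g_phi_symm p x y, S.g.symm p (S.phi p x) y]
    have h : Real.exp (2 * w) = Real.exp w * Real.exp w := by rw [← Real.exp_add]; ring_nf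
    simp [h]
    ring

/-- The structure tensor `F(x, y, z) = g((∇_x φ)y, z)`, where `(∇_x φ)y = ∇_x(φ y) - φ(∇_x y)`. -/
def structureTensor (p : M) (x y z : TangentSpace (𝓡 (2 * n + 1)) p) : ℝ :=
  let Y : Π q : M, TangentSpace (𝓡 (2 * n + 1)) q :=
    FiberBundle.extend (EuclideanSpace ℝ (Fin (2 * n + 1))) y
  S.g.inner p (leviCivita S.g (fun q ↦ S.phi q (Y q)) p x - S.phi p (leviCivita S.g Y p x)) z

/-- The para-Sasaki-like condition: for all horizontal vectors `X`, `Y`, `Z` one has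
`F(X, Y, Z) = F(ξ, Y, Z) = F(ξ, ξ, Z) = 0` and `F(X, Y, ξ) = -g(X, Y)`. -/
def IsParaSasakiLike : Prop :=
  ∀ (p : M) (X Y Z : TangentSpace (𝓡 (2 * n + 1)) p),
    S.eta p X = 0 → S.eta p Y = 0 → S.eta p Z = 0 →
      S.structureTensor p X Y Z = 0 ∧
      S.structureTensor p (S.xi p) Y Z = 0 ∧
      S.structureTensor p (S.xi p) (S.xi p) Z = 0 ∧
      S.structureTensor p X Y (S.xi p) = - S.g.inner p X Y

/-- The `*`-scalar curvature `Scal* = ∑ᵢ Ric(eᵢ, φ eᵢ)`. -/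
def scalStar (p : M) : ℝ :=
  ∑ i, ricci S.g p (orthonormalBasis S.g p i) (S.phi p (orthonormalBasis S.g p i))

end AlmostParacontactParacomplexRiemannian

end ParaSasaki

end

/-!
Write `∇` for the Levi-Civita connection of `g`. The para-Sasaki-like conditions prescribe the
tensor `F` on horizontal vectors and on `ξ`; as `F` is symmetric in its last two arguments, they
determine it completely:
`(∇_x φ)y = -g(x, y)ξ - η(y)x + 2η(x)η(y)ξ`, and `∇_x ξ = φ x`
(`IsParaSasakiLike.phiDeriv_eq`, `IsParaSasakiLike.leviCivita_xi`). The transformed metric `g'` has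
the form `a g(x, y) + b g(x, φ y) + c η(x)η(y)` with constant coefficients, so its covariant
derivative is explicit and the Koszul formula gives `∇'_x y = ∇_x y + A(x, y)ξ` with
`A(x, y) = α g(x, φ y) + β g(φ x, φ y)`
(`IsParaSasakiLike.leviCivita_paracontactHomothety`).

Since `A(x, ξ) = 0`, no quadratic terms appear in the curvature:
`R'(x, y)z = R(x, y)z + A(y, z)φ x - A(x, z)φ y + B(x, y, z)ξ`
(`IsParaSasakiLike.curvature_paracontactHomothety`). On taking the trace over `x` the first
correction vanishes, because `φ` is traceless (`trace_phi`; this is where the equal dimensions of the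
eigenspaces enter), and the other two cancel. Hence `Ric' = Ric`.

For the scalar curvatures let `L` be the endomorphism with `g(L x, y) = Ric(x, y)`,
so that `Scal = tr L` and `Scal* = tr (φ L)`. If `g(x, y) = g'(K x, y)`, then `K L` plays the same role
for `g'`. The endomorphism `K` is an explicit combination of `id`, `φ` and `η ⊗ ξ`
(`inner_homothetyEnd`), and besides `tr L` and `tr (φ L)` only `η(L ξ) = Ric(ξ, ξ) = -2n` is needed,
which follows from `R(x, y)ξ = η(x)y - η(y)x` (`IsParaSasakiLike.curvature_xi`).

The analytic prerequisites hold for every smooth Riemannian metric: the Levi-Civita derivative of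
`C²` fields is differentiable (`IsLeviCivita.mdifferentiableAt`), the curvature is trilinear, and it
depends on its last field only through the value at the point (`curvatureOn_eq_of_apply_eq`).
-/

namespace ParaSasaki

open scoped Topology

section LeviCivita

variable {E : Type*} [NormedAddCommGroup E] [NormedSpace ℝ E] [FiniteDimensional ℝ E]
  {H : Type*} [TopologicalSpace H] {I : ModelWithCorners ℝ E H}
  {M : Type*} [TopologicalSpace M] [ChartedSpace H M] [IsManifold I ∞ M]

/-! ### Differentiability of fields and functions -/

/-- The local extension of tangent vectors to vector fields is linear near the base point (away from
the base set of the trivialization the extension is a junk value). -/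
theorem extend_add {p : M} (v w : TangentSpace I p) :
    (FiberBundle.extend E (v + w) : Π q : M, TangentSpace I q) =ᶠ[𝓝 p]
      FiberBundle.extend E v + FiberBundle.extend E w := by
  let t := trivializationAt E (TangentSpace I : M → Type _) p
  have hp : p ∈ t.baseSet := FiberBundle.mem_baseSet_trivializationAt' p
  filter_upwards [t.open_baseSet.mem_nhds hp] with q hq
  change t.symm q (t ⟨p, v + w⟩).2 = t.symm q (t ⟨p, v⟩).2 + t.symm q (t ⟨p, w⟩).2
  rw [(t.linear ℝ hp).map_add, ← t.symmL_apply (R := ℝ) hq, ← t.symmL_apply (R := ℝ) hq,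
    ← t.symmL_apply (R := ℝ) hq, map_add]

theorem extend_smul {p : M} (c : ℝ) (v : TangentSpace I p) :
    (FiberBundle.extend E (c • v) : Π q : M, TangentSpace I q) =ᶠ[𝓝 p]
      c • FiberBundle.extend E v := by
  let t := trivializationAt E (TangentSpace I : M → Type _) p
  have hp : p ∈ t.baseSet := FiberBundle.mem_baseSet_trivializationAt' p
  filter_upwards [t.open_baseSet.mem_nhds hp] with q hq
  change t.symm q (t ⟨p, c • v⟩).2 = c • t.symm q (t ⟨p, v⟩).2
  rw [(t.linear ℝ hp).map_smul, ← t.symmL_apply (R := ℝ) hq, ← t.symmL_apply (R := ℝ) hq, map_smul]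

theorem contMDiffAt_mvfderiv_apply {f : M → ℝ} {X : Π p : M, TangentSpace I p} {p : M}
    (hf : ContMDiffAt I 𝓘(ℝ) 2 f p) (hX : CMDiffAt 1 (T% X) p) :
    ContMDiffAt I 𝓘(ℝ) 1 (fun q ↦ mvfderiv I f q (X q)) p := by
  have h := hf.mfderiv_const (m := 1) (by norm_num)
  have h2 := ContMDiffAt.clm_apply_of_inCoordinates (F₁ := E) (E₁ := (TangentSpace I : M → Type _))
    (F₂ := ℝ) (E₂ := (TangentSpace 𝓘(ℝ) : ℝ → Type _)) (n := 1) (b₁ := id) (b₂ := f) (v := X)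
    (ϕ := fun q ↦ mfderiv I 𝓘(ℝ) f q) (m₀ := p) h hX (hf.of_le (by norm_num))
  rw [contMDiffAt_totalSpace] at h2
  have h3 := h2.2
  simp only [trivializationAt_model_space_apply] at h3
  exact h3

theorem contMDiffAt_inner {n : WithTop ℕ∞} (hn : n ≤ ∞) (g : SmoothRiemannianMetric E I M)
    {X Y : Π p : M, TangentSpace I p} {p : M}
    (hX : CMDiffAt n (T% X) p) (hY : CMDiffAt n (T% Y) p) :
    ContMDiffAt I 𝓘(ℝ) n (fun q ↦ g.inner q (X q) (Y q)) p := by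
  have h := ContMDiffAt.clm_bundle_apply₂ (F₃ := ℝ) (E₃ := Bundle.Trivial M ℝ)
    (g.contMDiff.contMDiffAt.of_le hn) hX hY
  rw [contMDiffAt_totalSpace] at h
  exact h.2

theorem contMDiffAt_mlieBracket {X Y : Π p : M, TangentSpace I p} {p : M}
    (hX : CMDiffAt 2 (T% X) p) (hY : CMDiffAt 2 (T% Y) p) :
    CMDiffAt 1 (T% (mlieBracket I X Y)) p := by
  have : IsManifold I (((2 : ℕ∞) : WithTop ℕ∞) + 1) M :=
    IsManifold.of_le (n := ∞) (by exact_mod_cast le_top)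
  have : IsManifold I (minSmoothness ℝ 2) M := by
    rw [minSmoothness_of_isRCLikeNormedField]; infer_instance
  exact ContMDiffAt.mlieBracket_vectorField (m := 1) (n := 2) hX hY (by simp; norm_num)

theorem mdifferentiableAt_koszul (g : SmoothRiemannianMetric E I M)
    {X Y Z : Π p : M, TangentSpace I p} {p : M}
    (hX : CMDiffAt 2 (T% X) p) (hY : CMDiffAt 2 (T% Y) p)
    (hZ : CMDiffAt 2 (T% Z) p) : MDiffAt (koszul g X Y Z) p := by
  have h2 : (2 : WithTop ℕ∞) ≤ ∞ := ENat.LEInfty.out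
  have h12 : (1 : WithTop ℕ∞) ≤ 2 := by norm_num
  have h1 : (1 : WithTop ℕ∞) ≤ ∞ := ENat.LEInfty.out
  refine (ContMDiffAt.mdifferentiableAt (n := 1) ?_ one_ne_zero)
  have d {A B C : Π p : M, TangentSpace I p} (hA : CMDiffAt 2 (T% A) p)
    (hB : CMDiffAt 2 (T% B) p) (hC : CMDiffAt 2 (T% C) p) := 
    contMDiffAt_mvfderiv_apply (contMDiffAt_inner h2 g hA hB) (hC.of_le h12)
  have e {A B C : Π p : M, TangentSpace I p} (hA : CMDiffAt 2 (T% A) p)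
    (hB : CMDiffAt 2 (T% B) p) (hC : CMDiffAt 2 (T% C) p) :=
    contMDiffAt_inner h1 g (contMDiffAt_mlieBracket hA hB) (hC.of_le h12)
  exact (((((d hY hZ hX).add (d hZ hX hY)).sub (d hX hY hZ)).add (e hX hY hZ)).add
    (e hZ hX hY)).add (e hZ hY hX)

/-- A vector field is differentiable as soon as its inner products with the extensions of all
tangent vectors are: in a trivialization, the metric is an invertible matrix depending smoothly on
the point. -/
theorem mdifferentiableAt_of_inner (g : SmoothRiemannianMetric E I M)
    {V : Π p : M, TangentSpace I p} {p : M}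
    (h : ∀ w : TangentSpace I p, MDiffAt (fun q ↦ g.inner q (V q) (FiberBundle.extend E w q)) p) :
    MDiffAt (T% V) p := by
  let t := trivializationAt E (TangentSpace I : M → Type _) p
  have hp : p ∈ t.baseSet := FiberBundle.mem_baseSet_trivializationAt' p
  have hnhds := t.open_baseSet.mem_nhds hp
  -- `C` is the metric and `k` the covector `g(V, ·)`, both read in the trivialization.
  let C : M → E →L[ℝ] E →L[ℝ] ℝ := fun x ↦ ContinuousLinearMap.inCoordinates E (TangentSpace I)
    (E →L[ℝ] ℝ) (fun x ↦ TangentSpace I x →L[ℝ] ℝ) p x p x (g.inner x)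
  have hC : ∀ x ∈ t.baseSet, ∀ a b, C x a b = g.inner x (t.symm x a) (t.symm x b) := by
    intro x hx a b
    exact (inCoordinates_apply_eq₂ (𝕜 := ℝ) (F₃ := ℝ) (E₃ := Bundle.Trivial M ℝ) (ϕ := g.inner x)
      hx hx (Set.mem_univ _)).trans (by simp [t])
  have hCd : ContMDiffAt I 𝓘(ℝ, E →L[ℝ] E →L[ℝ] ℝ) ∞ C p :=
    ((contMDiffAt_hom_bundle _).1 g.contMDiff.contMDiffAt).2
  have hinv : ∀ x ∈ t.baseSet, (C x).IsInvertible := by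
    intro x hx
    have hinj : Function.Injective (C x) := by
      rw [injective_iff_map_eq_zero]
      intro a ha
      by_contra hne
      have hne' : t.symm x a ≠ 0 := fun h0 ↦ hne <| by
        have h1 : (t (⟨x, t.symm x a⟩ : TotalSpace E (TangentSpace I : M → Type _))).2 = a := by
          rw [t.apply_mk_symm hx]
        rw [← h1, h0]
        exact (t.linear ℝ hx).map_zero
      have h1 := g.pos x _ hne'
      rw [← hC x hx, ha] at h1
      simp at h1
    have hd : finrank ℝ E = finrank ℝ (E →L[ℝ] ℝ) := by
      rw [← (LinearMap.toContinuousLinearMap : (E →ₗ[ℝ] ℝ) ≃ₗ[ℝ] _).finrank_eq,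
        Subspace.dual_finrank_eq]
    exact ⟨(LinearEquiv.ofInjectiveOfFinrankEq (C x).toLinearMap hinj hd).toContinuousLinearEquiv, by
      ext; rfl⟩
  let e := Module.finBasis ℝ E
  let k : M → E →L[ℝ] ℝ := fun x ↦ ∑ i, g.inner x (V x) (t.symm x (e i)) •
    (e.coord i).toContinuousLinearMap
  have hk : MDifferentiableAt I 𝓘(ℝ, E →L[ℝ] ℝ) k p := by
    have hi : ∀ i, MDiffAt (fun x ↦ g.inner x (V x) (t.symm x (e i))) p := fun i ↦ by
      refine (h (t.symm p (e i))).congr_of_eventuallyEq (Filter.Eventually.of_forall fun x ↦ ?_)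
      change _ = g.inner x (V x) (t.symm x (t ⟨p, t.symm p (e i)⟩).2)
      rw [t.apply_mk_symm hp]
    have hs := MDifferentiableAt.sum (t := Finset.univ) fun i _ ↦ (hi i).smul
      (mdifferentiableAt_const (c := (e.coord i).toContinuousLinearMap))
    have hke : k = ∑ i, (fun x ↦ g.inner x (V x) (t.symm x (e i))) •
        fun _ ↦ (e.coord i).toContinuousLinearMap := by
      funext x
      simp [k]
    rwa [hke]
  have hloc : ∀ x ∈ t.baseSet, (t ⟨x, V x⟩).2 = (C x).inverse (k x) := by
    intro x hx
    have : k x = C x (t ⟨x, V x⟩).2 := by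
      refine ContinuousLinearMap.coe_injective (e.ext fun i ↦ ?_)
      rw [ContinuousLinearMap.coe_coe, ContinuousLinearMap.coe_coe, hC x hx]
      rw [show t.symm x (t ⟨x, V x⟩).2 = V x from t.symm_apply_apply_mk hx _]
      simp [k, Finsupp.single_apply]
    obtain ⟨c, hc⟩ := hinv x hx
    rw [this, ← hc, ContinuousLinearMap.inverse_equiv]
    exact (c.symm_apply_apply _).symm
  rw [mdifferentiableAt_totalSpace]
  refine ⟨mdifferentiableAt_id, ?_⟩
  have hci : MDifferentiableAt I 𝓘(ℝ, (E →L[ℝ] ℝ) →L[ℝ] E) (fun x ↦ (C x).inverse) p := by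
    have h1 : ContDiffAt ℝ 1 ContinuousLinearMap.inverse (C p) := (hinv p hp).contDiffAt_map_inverse
    have h2 := ContDiffAt.comp_contMDiffAt (f := C) h1 (hCd.of_le ENat.LEInfty.out)
    exact h2.mdifferentiableAt one_ne_zero
  refine (hci.clm_apply hk).congr_of_eventuallyEq ?_
  filter_upwards [hnhds] with x hx
  exact hloc x hx

/-! ### The Levi-Civita connection and its curvature -/

theorem IsLeviCivita.two_mul_inner_eq_koszul {g : SmoothRiemannianMetric E I M}
    {cov : CovariantDerivative I E (TangentSpace I : M → Type _)} (h : IsLeviCivita g cov)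
    {X Y Z : Π p : M, TangentSpace I p} {p : M}
    (hX : MDiffAt (T% X) p) (hY : MDiffAt (T% Y) p) (hZ : MDiffAt (T% Z) p) :
    2 * g.inner p (cov Y p (X p)) (Z p) = koszul g X Y Z p := by
  simp only [koszul, h.metric _ hY hZ, h.metric _ hZ hX, h.metric _ hX hY, ← h.torsion_free hX hY,
    ← h.torsion_free hZ hX, ← h.torsion_free hZ hY, map_sub, sub_apply]
  rw [g.symm p (Y p) (cov Z p (X p)), g.symm p (Z p) (cov X p (Y p)),
    g.symm p (X p) (cov Y p (Z p))]
  ring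

theorem eventually_mdifferentiableAt {X : Π p : M, TangentSpace I p} {p : M}
    (hX : CMDiffAt 2 (T% X) p) : ∀ᶠ q in 𝓝 p, MDiffAt (T% X) q :=
  ((contMDiffAt_iff_contMDiffAt_nhds (by simp)).1 hX).mono
    fun _ h ↦ h.mdifferentiableAt two_ne_zero

/-- The Levi-Civita derivative of a `C²` field along a `C²` field is differentiable, since its inner
products are given by the Koszul formula. -/
theorem IsLeviCivita.mdifferentiableAt {g : SmoothRiemannianMetric E I M}
    {cov : CovariantDerivative I E (TangentSpace I : M → Type _)} (h : IsLeviCivita g cov)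
    {X Y : Π p : M, TangentSpace I p} {p : M}
    (hX : CMDiffAt 2 (T% X) p) (hY : CMDiffAt 2 (T% Y) p) :
    MDiffAt (T% fun q ↦ cov Y q (X q)) p := by
  refine mdifferentiableAt_of_inner g fun w ↦ ?_
  have hw : CMDiffAt 2 (T% (FiberBundle.extend E w : Π q : M, TangentSpace I q)) p :=
    FiberBundle.contMDiffAt_extend I E w
  have hk : MDiffAt (fun q ↦ 2⁻¹ * koszul g X Y (FiberBundle.extend E w) q) p :=
    mdifferentiableAt_const.mul (mdifferentiableAt_koszul g hX hY hw)
  refine hk.congr_of_eventuallyEq ?_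
  filter_upwards [eventually_mdifferentiableAt hX, eventually_mdifferentiableAt hY,
    eventually_mdifferentiableAt hw] with q h1 h2 h3
  rw [← h.two_mul_inner_eq_koszul h1 h2 h3]
  ring

/-- The curvature expression `∇_X ∇_Y Z - ∇_Y ∇_X Z - ∇_[X, Y] Z` of three vector fields. -/
noncomputable def curvatureOn (cov : CovariantDerivative I E (TangentSpace I : M → Type _))
    (X Y Z : Π p : M, TangentSpace I p) (p : M) : TangentSpace I p :=
  cov (fun q ↦ cov Z q (Y q)) p (X p) - cov (fun q ↦ cov Z q (X q)) p (Y p)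
    - cov Z p (mlieBracket I X Y p)

theorem curvature_eq_curvatureOn (g : SmoothRiemannianMetric E I M) (p : M)
    (x y z : TangentSpace I p) :
    curvature g p x y z = curvatureOn (leviCivita g) (FiberBundle.extend E x)
      (FiberBundle.extend E y) (FiberBundle.extend E z) p := rfl

theorem curvatureOn_swap (cov : CovariantDerivative I E (TangentSpace I : M → Type _))
    (X Y Z : Π p : M, TangentSpace I p) (p : M) :
    curvatureOn cov X Y Z p = - curvatureOn cov Y X Z p := by
  rw [curvatureOn, curvatureOn, mlieBracket_swap_apply, map_neg]
  abel

section

variable {g : SmoothRiemannianMetric E I M}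
  {cov : CovariantDerivative I E (TangentSpace I : M → Type _)} {p : M}
  {X X' Y Z Z' : Π p : M, TangentSpace I p}

theorem cov_congr (hZ : MDiffAt (T% Z) p) (h : Z =ᶠ[𝓝 p] Z') : cov Z p = cov Z' p := by
  have hZ' : MDiffAt (T% Z') p := hZ.congr_of_eventuallyEq <| h.mono fun q hq ↦ by simp [hq]
  exact cov.isCovariantDerivativeOnUniv.congr_of_eventuallyEq hZ hZ' Filter.univ_mem h

theorem curvatureOn_congr_left (hcov : IsLeviCivita g cov) (hX : CMDiffAt 2 (T% X) p)
    (hZ : CMDiffAt 2 (T% Z) p) (h : X =ᶠ[𝓝 p] X') :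
    curvatureOn cov X Y Z p = curvatureOn cov X' Y Z p := by
  have h1 : cov (fun q ↦ cov Z q (X q)) p = cov (fun q ↦ cov Z q (X' q)) p :=
    cov_congr (hcov.mdifferentiableAt hX hZ) <| h.mono fun q hq ↦ congrArg (cov Z q) hq
  have h2 : mlieBracket I X Y p = mlieBracket I X' Y p :=
    h.mlieBracket_vectorField_eq Filter.EventuallyEq.rfl
  rw [curvatureOn, curvatureOn, h1, h2, h.self_of_nhds]

theorem curvatureOn_congr_right (hcov : IsLeviCivita g cov) (hX : CMDiffAt 2 (T% X) p)
    (hY : CMDiffAt 2 (T% Y) p) (hZ : CMDiffAt 2 (T% Z) p) (h : Z =ᶠ[𝓝 p] Z') :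
    curvatureOn cov X Y Z p = curvatureOn cov X Y Z' p := by
  have key {W : Π p : M, TangentSpace I p} (hW : CMDiffAt 2 (T% W) p) :
      cov (fun q ↦ cov Z q (W q)) p = cov (fun q ↦ cov Z' q (W q)) p := by
    refine cov_congr (hcov.mdifferentiableAt hW hZ) ?_
    filter_upwards [eventually_mdifferentiableAt hZ, h.eventuallyEq_nhds] with q h1 h2
    rw [cov_congr h1 h2]
  rw [curvatureOn, curvatureOn, key hX, key hY,
    cov_congr (hZ.mdifferentiableAt two_ne_zero) h]

theorem curvatureOn_add_left (hcov : IsLeviCivita g cov) (hX : CMDiffAt 2 (T% X) p)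
    (hX' : CMDiffAt 2 (T% X') p) (hZ : CMDiffAt 2 (T% Z) p) :
    curvatureOn cov (X + X') Y Z p = curvatureOn cov X Y Z p + curvatureOn cov X' Y Z p := by
  have h1 : (fun q ↦ cov Z q ((X + X') q)) = (fun q ↦ cov Z q (X q)) + fun q ↦ cov Z q (X' q) := by
    funext q; simp
  simp only [curvatureOn]
  rw [h1, cov.isCovariantDerivativeOnUniv.add (hcov.mdifferentiableAt hX hZ)
    (hcov.mdifferentiableAt hX' hZ), mlieBracket_add_left (hX.mdifferentiableAt two_ne_zero)
    (hX'.mdifferentiableAt two_ne_zero)]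
  simp only [Pi.add_apply, map_add, add_apply]
  abel

theorem curvatureOn_smul_left (hcov : IsLeviCivita g cov) (c : ℝ) (hX : CMDiffAt 2 (T% X) p)
    (hZ : CMDiffAt 2 (T% Z) p) :
    curvatureOn cov (c • X) Y Z p = c • curvatureOn cov X Y Z p := by
  have h1 : (fun q ↦ cov Z q ((c • X) q)) = c • fun q ↦ cov Z q (X q) := by
    funext q; simp
  simp only [curvatureOn]
  rw [h1, cov.isCovariantDerivativeOnUniv.smul_const c (hcov.mdifferentiableAt hX hZ),
    mlieBracket_const_smul_left (hX.mdifferentiableAt two_ne_zero)]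
  simp only [Pi.smul_apply, map_smul, smul_apply, smul_sub]

theorem curvatureOn_add_right (hcov : IsLeviCivita g cov) (hX : CMDiffAt 2 (T% X) p)
    (hY : CMDiffAt 2 (T% Y) p) (hZ : CMDiffAt 2 (T% Z) p) (hZ' : CMDiffAt 2 (T% Z') p) :
    curvatureOn cov X Y (Z + Z') p = curvatureOn cov X Y Z p + curvatureOn cov X Y Z' p := by
  have key {W : Π p : M, TangentSpace I p} (hW : CMDiffAt 2 (T% W) p) :
      cov (fun q ↦ cov (Z + Z') q (W q)) p =
        cov (fun q ↦ cov Z q (W q)) p + cov (fun q ↦ cov Z' q (W q)) p := by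
    have h1 := hcov.mdifferentiableAt hW hZ
    have h2 := hcov.mdifferentiableAt hW hZ'
    rw [← cov.isCovariantDerivativeOnUniv.add h1 h2]
    refine (cov_congr (mdifferentiableAt_add_section h1 h2) ?_).symm
    filter_upwards [eventually_mdifferentiableAt hZ, eventually_mdifferentiableAt hZ'] with q h3 h4
    rw [cov.isCovariantDerivativeOnUniv.add h3 h4]
    rfl
  simp only [curvatureOn]
  rw [key hX, key hY, cov.isCovariantDerivativeOnUniv.add (hZ.mdifferentiableAt two_ne_zero)
    (hZ'.mdifferentiableAt two_ne_zero)]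
  simp only [add_apply]
  abel

theorem curvatureOn_smul_right (hcov : IsLeviCivita g cov) (c : ℝ) (hX : CMDiffAt 2 (T% X) p)
    (hY : CMDiffAt 2 (T% Y) p) (hZ : CMDiffAt 2 (T% Z) p) :
    curvatureOn cov X Y (c • Z) p = c • curvatureOn cov X Y Z p := by
  have key {W : Π p : M, TangentSpace I p} (hW : CMDiffAt 2 (T% W) p) :
      cov (fun q ↦ cov (c • Z) q (W q)) p = c • cov (fun q ↦ cov Z q (W q)) p := by
    have h1 := hcov.mdifferentiableAt hW hZ
    rw [← cov.isCovariantDerivativeOnUniv.smul_const c h1]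
    refine (cov_congr (mdifferentiableAt_const.smul_section h1) ?_).symm
    filter_upwards [eventually_mdifferentiableAt hZ] with q h3
    rw [cov.isCovariantDerivativeOnUniv.smul_const c h3]
    rfl
  simp only [curvatureOn]
  rw [key hX, key hY,
    cov.isCovariantDerivativeOnUniv.smul_const c (hZ.mdifferentiableAt two_ne_zero)]
  simp only [smul_apply, smul_sub]

end

theorem contMDiffAt_two_extend {p : M} (v : TangentSpace I p) :
    CMDiffAt 2 (T% (FiberBundle.extend E v : Π q : M, TangentSpace I q)) p :=
  FiberBundle.contMDiffAt_extend I E v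

theorem curvature_swap (g : SmoothRiemannianMetric E I M) (p : M) (x y z : TangentSpace I p) :
    curvature g p x y z = - curvature g p y x z :=
  curvatureOn_swap ..

theorem curvature_add_left (g : SmoothRiemannianMetric E I M) (p : M)
    (x x' y z : TangentSpace I p) :
    curvature g p (x + x') y z = curvature g p x y z + curvature g p x' y z := by
  have h := isLeviCivita_leviCivita g
  simp only [curvature_eq_curvatureOn]
  rw [curvatureOn_congr_left h (contMDiffAt_two_extend _) (contMDiffAt_two_extend _)
    (extend_add x x'), curvatureOn_add_left h (contMDiffAt_two_extend _)
    (contMDiffAt_two_extend _) (contMDiffAt_two_extend _)]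

theorem curvature_smul_left (g : SmoothRiemannianMetric E I M) (p : M) (c : ℝ)
    (x y z : TangentSpace I p) :
    curvature g p (c • x) y z = c • curvature g p x y z := by
  have h := isLeviCivita_leviCivita g
  simp only [curvature_eq_curvatureOn]
  rw [curvatureOn_congr_left h (contMDiffAt_two_extend _) (contMDiffAt_two_extend _)
    (extend_smul c x), curvatureOn_smul_left h c (contMDiffAt_two_extend _)
    (contMDiffAt_two_extend _)]

theorem curvature_add_right (g : SmoothRiemannianMetric E I M) (p : M)
    (x y z z' : TangentSpace I p) :
    curvature g p x y (z + z') = curvature g p x y z + curvature g p x y z' := by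
  have h := isLeviCivita_leviCivita g
  simp only [curvature_eq_curvatureOn]
  rw [curvatureOn_congr_right h (contMDiffAt_two_extend _) (contMDiffAt_two_extend _)
    (contMDiffAt_two_extend _) (extend_add z z'), curvatureOn_add_right h
    (contMDiffAt_two_extend _) (contMDiffAt_two_extend _) (contMDiffAt_two_extend _)
    (contMDiffAt_two_extend _)]

theorem curvature_smul_right (g : SmoothRiemannianMetric E I M) (p : M) (c : ℝ)
    (x y z : TangentSpace I p) :
    curvature g p x y (c • z) = c • curvature g p x y z := by
  have h := isLeviCivita_leviCivita g
  simp only [curvature_eq_curvatureOn]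
  rw [curvatureOn_congr_right h (contMDiffAt_two_extend _) (contMDiffAt_two_extend _)
    (contMDiffAt_two_extend _) (extend_smul c z), curvatureOn_smul_right h c
    (contMDiffAt_two_extend _) (contMDiffAt_two_extend _) (contMDiffAt_two_extend _)]

theorem curvature_add_mid (g : SmoothRiemannianMetric E I M) (p : M)
    (x y y' z : TangentSpace I p) :
    curvature g p x (y + y') z = curvature g p x y z + curvature g p x y' z := by
  rw [curvature_swap, curvature_add_left, neg_add, ← curvature_swap, ← curvature_swap]

theorem curvature_smul_mid (g : SmoothRiemannianMetric E I M) (p : M) (c : ℝ)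
    (x y z : TangentSpace I p) :
    curvature g p x (c • y) z = c • curvature g p x y z := by
  rw [curvature_swap, curvature_smul_left, ← smul_neg, ← curvature_swap]

/-- The endomorphism `x ↦ R(x, y)z` of the tangent space, whose trace is `Ric(y, z)`. -/
noncomputable def curvatureEnd (g : SmoothRiemannianMetric E I M) (p : M) (y z : TangentSpace I p) :
    TangentSpace I p →ₗ[ℝ] TangentSpace I p where
  toFun x := curvature g p x y z
  map_add' x x' := curvature_add_left g p x x' y z
  map_smul' c x := curvature_smul_left g p c x y z

theorem curvatureEnd_apply (g : SmoothRiemannianMetric E I M) (p : M) (x y z : TangentSpace I p) :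
    curvatureEnd g p y z x = curvature g p x y z := rfl

section

variable (g : SmoothRiemannianMetric E I M) {p : M} {ι : Type*} [Fintype ι] [DecidableEq ι]

theorem trace_eq_sum_inner (e : Basis ι ℝ (TangentSpace I p))
    (he : ∀ i j, g.inner p (e i) (e j) = if i = j then 1 else 0)
    (L : TangentSpace I p →ₗ[ℝ] TangentSpace I p) :
    LinearMap.trace ℝ _ L = ∑ i, g.inner p (L (e i)) (e i) := by
  rw [LinearMap.trace_eq_matrix_trace ℝ e, Matrix.trace]
  refine Finset.sum_congr rfl fun i _ ↦ ?_
  rw [Matrix.diag_apply, LinearMap.toMatrix_apply]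
  conv_rhs => rw [← e.sum_repr (L (e i))]
  simp only [map_sum, map_smul, sum_apply, smul_apply, he, smul_eq_mul, mul_ite, mul_one, mul_zero,
    Finset.sum_ite_eq', Finset.mem_univ, if_true]

/-- Every bilinear form on the tangent space is represented by an endomorphism through the metric. -/
theorem exists_inner_eq (B : TangentSpace I p →ₗ[ℝ] TangentSpace I p →ₗ[ℝ] ℝ) :
    ∃ L : TangentSpace I p →ₗ[ℝ] TangentSpace I p, ∀ x y, g.inner p (L x) y = B x y := by
  obtain ⟨s, hs⟩ := exists_musical g p
  have : FiniteDimensional ℝ (TangentSpace I p) := inferInstanceAs (FiniteDimensional ℝ E)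
  have : T2Space (TangentSpace I p) := inferInstanceAs (T2Space E)
  refine ⟨s.toLinearMap ∘ₗ LinearMap.toContinuousLinearMap.toLinearMap ∘ₗ B, fun x y ↦ ?_⟩
  simp [hs]

end

theorem ricci_eq_trace (g : SmoothRiemannianMetric E I M) (p : M) (x y : TangentSpace I p) :
    ricci g p x y = LinearMap.trace ℝ _ (curvatureEnd g p x y) :=
  (trace_eq_sum_inner g _ (orthonormalBasis_inner g p) (curvatureEnd g p x y)).symm

/-- The Ricci tensor as a bilinear form. -/
noncomputable def ricciForm (g : SmoothRiemannianMetric E I M) (p : M) :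
    TangentSpace I p →ₗ[ℝ] TangentSpace I p →ₗ[ℝ] ℝ :=
  LinearMap.mk₂ ℝ (ricci g p)
    (fun x x' y ↦ by
      simp only [ricci, curvature_add_mid, map_add, add_apply, Finset.sum_add_distrib])
    (fun c x y ↦ by
      simp only [ricci, curvature_smul_mid, map_smul, smul_apply, Finset.smul_sum])
    (fun x y y' ↦ by
      simp only [ricci, curvature_add_right, map_add, add_apply, Finset.sum_add_distrib])
    (fun c x y ↦ by
      simp only [ricci, curvature_smul_right, map_smul, smul_apply, Finset.smul_sum])

theorem ricciForm_apply (g : SmoothRiemannianMetric E I M) (p : M) (x y : TangentSpace I p) :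
    ricciForm g p x y = ricci g p x y := rfl

/-! ### Tensoriality of the curvature in the last argument -/

theorem mvfderiv_congr {f f' : M → ℝ} {p : M} (h : f =ᶠ[𝓝 p] f') :
    mvfderiv I f p = mvfderiv I f' p := by
  ext v
  change (mfderiv I 𝓘(ℝ) f p v : ℝ) = mfderiv I 𝓘(ℝ) f' p v
  rw [h.mfderiv_eq]
  rfl

/-- The Lie bracket is the commutator of derivations. Expanding the Jacobi identity for `X`, `Y` and
`f • Z` by the product rule leaves `([X, Y]f - X(Yf) + Y(Xf)) • Z = 0`. -/
theorem mvfderiv_mlieBracket {f : M → ℝ} {X Y : Π p : M, TangentSpace I p} {p : M}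
    (hf : ContMDiffAt I 𝓘(ℝ) 2 f p) (hX : CMDiffAt 2 (T% X) p) (hY : CMDiffAt 2 (T% Y) p) :
    mvfderiv I f p (mlieBracket I X Y p) =
      mvfderiv I (fun q ↦ mvfderiv I f q (Y q)) p (X p)
        - mvfderiv I (fun q ↦ mvfderiv I f q (X q)) p (Y p) := by
  by_cases htriv : ∃ z : TangentSpace I p, z ≠ 0
  swap
  · push Not at htriv
    simp [htriv (mlieBracket I X Y p), htriv (X p), htriv (Y p)]
  obtain ⟨z, hz⟩ := htriv
  let Z : Π p : M, TangentSpace I p := FiberBundle.extend E z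
  have hZ : CMDiffAt 2 (T% Z) p := FiberBundle.contMDiffAt_extend I E z
  have hZp : Z p = z := FiberBundle.extend_apply_self ..
  have : IsManifold I (minSmoothness ℝ 3) M := by
    rw [minSmoothness_of_isRCLikeNormedField]
    exact IsManifold.of_le (n := ∞) ENat.LEInfty.out
  have h2 : minSmoothness ℝ 2 = 2 := minSmoothness_of_isRCLikeNormedField
  have key {U V : Π p : M, TangentSpace I p} (hU : CMDiffAt 2 (T% U) p)
      (hV : CMDiffAt 2 (T% V) p) :
      mlieBracket I U (mlieBracket I V (f • Z)) p =
        f p • mlieBracket I U (mlieBracket I V Z) p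
          + mvfderiv I f p (U p) • mlieBracket I V Z p
          + mvfderiv I f p (V p) • mlieBracket I U Z p
          + mvfderiv I (fun q ↦ mvfderiv I f q (V q)) p (U p) • Z p := by
    have hfd := hf.mdifferentiableAt two_ne_zero
    have hZd := hZ.mdifferentiableAt two_ne_zero
    have hVZ := (contMDiffAt_mlieBracket hV hZ).mdifferentiableAt one_ne_zero
    have hVf := (contMDiffAt_mvfderiv_apply hf (hV.of_le one_le_two)).mdifferentiableAt one_ne_zero
    have h1 : mlieBracket I V (f • Z) =ᶠ[𝓝 p]
        ((fun q ↦ mvfderiv I f q (V q)) • Z + f • mlieBracket I V Z :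
          Π p : M, TangentSpace I p) := by
      filter_upwards [(contMDiffAt_iff_contMDiffAt_nhds (by simp)).1 hf,
        eventually_mdifferentiableAt hZ] with q hq1 hq2
      exact mlieBracket_smul_right (hq1.mdifferentiableAt two_ne_zero) hq2
    have h3 : mlieBracket I U (mlieBracket I V (f • Z)) p = mlieBracket I U
        ((fun q ↦ mvfderiv I f q (V q)) • Z + f • mlieBracket I V Z) p :=
      Filter.EventuallyEq.rfl.mlieBracket_vectorField_eq h1
    rw [h3, mlieBracket_add_right (hVf.smul_section hZd) (hfd.smul_section hVZ),
      mlieBracket_smul_right hVf hZd, mlieBracket_smul_right hfd hVZ]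
    abel
  have hJ := leibniz_identity_mlieBracket_apply (by rwa [h2]) (by rwa [h2]) (W := f • Z)
    (U := X) (V := Y) (x := p) (by rw [h2]; exact hf.smul_section hZ)
  have hJ' := leibniz_identity_mlieBracket_apply (by rwa [h2]) (by rwa [h2]) (W := Z)
    (U := X) (V := Y) (x := p) (by rwa [h2])
  rw [key hX hY, key hY hX, mlieBracket_smul_right (hf.mdifferentiableAt two_ne_zero)
    (hZ.mdifferentiableAt two_ne_zero), hJ', hZp] at hJ
  have h0 : (mvfderiv I f p (mlieBracket I X Y p) -
      (mvfderiv I (fun q ↦ mvfderiv I f q (Y q)) p (X p)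
        - mvfderiv I (fun q ↦ mvfderiv I f q (X q)) p (Y p))) • z = 0 := by
    rw [← sub_eq_zero] at hJ
    rw [← neg_eq_zero, ← hJ]
    module
  rcases smul_eq_zero.1 h0 with h | h
  · exact sub_eq_zero.1 h
  · exact absurd h hz

/-- The curvature of the Levi-Civita connection is skew-symmetric. -/
theorem inner_curvatureOn {g : SmoothRiemannianMetric E I M}
    {cov : CovariantDerivative I E (TangentSpace I : M → Type _)} (h : IsLeviCivita g cov)
    {X Y Z W : Π p : M, TangentSpace I p} {p : M} (hX : CMDiffAt 2 (T% X) p)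
    (hY : CMDiffAt 2 (T% Y) p) (hZ : CMDiffAt 2 (T% Z) p) (hW : CMDiffAt 2 (T% W) p) :
    g.inner p (curvatureOn cov X Y Z p) (W p) = - g.inner p (Z p) (curvatureOn cov X Y W p) := by
  have hf : ContMDiffAt I 𝓘(ℝ) 2 (fun q ↦ g.inner q (Z q) (W q)) p :=
    contMDiffAt_inner ENat.LEInfty.out g hZ hW
  have hZ1 := hZ.mdifferentiableAt two_ne_zero
  have hW1 := hW.mdifferentiableAt two_ne_zero
  have key {U V : Π p : M, TangentSpace I p} (hU : CMDiffAt 2 (T% U) p)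
      (hV : CMDiffAt 2 (T% V) p) :
      mvfderiv I (fun q ↦ mvfderiv I (fun r ↦ g.inner r (Z r) (W r)) q (V q)) p (U p) =
        g.inner p (cov (fun q ↦ cov Z q (V q)) p (U p)) (W p)
          + g.inner p (cov Z p (V p)) (cov W p (U p))
          + (g.inner p (cov Z p (U p)) (cov W p (V p))
          + g.inner p (Z p) (cov (fun q ↦ cov W q (V q)) p (U p))) := by
    have hVZ := h.mdifferentiableAt hV hZ
    have hVW := h.mdifferentiableAt hV hW
    have h1 : (fun q ↦ mvfderiv I (fun r ↦ g.inner r (Z r) (W r)) q (V q)) =ᶠ[𝓝 p]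
        (fun q ↦ g.inner q (cov Z q (V q)) (W q)) + fun q ↦ g.inner q (Z q) (cov W q (V q)) := by
      filter_upwards [eventually_mdifferentiableAt hZ, eventually_mdifferentiableAt hW] with q h1 h2
      exact h.metric _ h1 h2
    rw [mvfderiv_congr h1, mvfderiv_add (mdiffAt_inner g hVZ hW1) (mdiffAt_inner g hZ1 hVW), add_apply,
      h.metric _ hVZ hW1, h.metric _ hZ1 hVW]
  have h1 := mvfderiv_mlieBracket hf hX hY
  rw [key hX hY, key hY hX, h.metric _ hZ1 hW1] at h1
  simp only [curvatureOn, map_sub, sub_apply]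
  linear_combination -h1

/-- Tensoriality of the curvature in its last argument, which follows from skew-symmetry because the
right-hand side of `inner_curvatureOn` only involves the value of `Z` at `p`. -/
theorem curvatureOn_eq_of_apply_eq {g : SmoothRiemannianMetric E I M}
    {cov : CovariantDerivative I E (TangentSpace I : M → Type _)} (h : IsLeviCivita g cov)
    {X Y Z Z' : Π p : M, TangentSpace I p} {p : M} (hX : CMDiffAt 2 (T% X) p)
    (hY : CMDiffAt 2 (T% Y) p) (hZ : CMDiffAt 2 (T% Z) p) (hZ' : CMDiffAt 2 (T% Z') p)
    (hZZ' : Z p = Z' p) : curvatureOn cov X Y Z p = curvatureOn cov X Y Z' p := by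
  refine metric_nondegenerate g fun w ↦ ?_
  have hw := contMDiffAt_two_extend w
  have h1 := inner_curvatureOn h hX hY hZ hw
  have h2 := inner_curvatureOn h hX hY hZ' hw
  rw [FiberBundle.extend_apply_self] at h1 h2
  rw [h1, h2, hZZ']

end LeviCivita

/-- Differentiability at `p` of a vector field, as a section of the tangent bundle. -/
abbrev VectorFieldMDiffAt {E : Type*} [NormedAddCommGroup E] [NormedSpace ℝ E]
    {H : Type*} [TopologicalSpace H] {I : ModelWithCorners ℝ E H}
    {M : Type*} [TopologicalSpace M] [ChartedSpace H M] [IsManifold I ∞ M]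
    (X : Π p : M, TangentSpace I p) (p : M) : Prop :=
  MDiffAt (T% X) p

namespace AlmostParacontactParacomplexRiemannian

variable {n : ℕ} {M : Type*} [TopologicalSpace M]
  [ChartedSpace (EuclideanSpace ℝ (Fin (2 * n + 1))) M] [IsManifold (𝓡 (2 * n + 1)) ∞ M]
  (S : AlmostParacontactParacomplexRiemannian n M)

/-! ### The covariant derivatives of `φ`, `ξ` and `η` -/

theorem mdifferentiableAt_phi {Y : Π p : M, TangentSpace (𝓡 (2 * n + 1)) p} {p : M}
    (hY : VectorFieldMDiffAt Y p) : VectorFieldMDiffAt (fun q ↦ S.phi q (Y q)) p :=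
  (S.contMDiff_phi.contMDiffAt.mdifferentiableAt (by simp)).clm_bundle_apply hY

theorem mdifferentiableAt_xi (p : M) : VectorFieldMDiffAt S.xi p :=
  S.contMDiff_xi.contMDiffAt.mdifferentiableAt (by simp)

theorem tensorialAt_phiDeriv (p : M) :
    TensorialAt (𝓡 (2 * n + 1)) (EuclideanSpace ℝ (Fin (2 * n + 1)))
      (fun Y : Π p : M, TangentSpace (𝓡 (2 * n + 1)) p ↦
        leviCivita S.g (fun q ↦ S.phi q (Y q)) p - S.phi p ∘L leviCivita S.g Y p) p where
  smul {f Y} hf hY := by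
    have h1 : (fun q ↦ S.phi q ((f • Y) q)) = f • fun q ↦ S.phi q (Y q) := by
      funext q; simp
    have hc := (leviCivita S.g).isCovariantDerivativeOnUniv
    rw [h1, hc.leibniz (S.mdifferentiableAt_phi hY) hf, hc.leibniz hY hf]
    ext x
    simp only [sub_apply, add_apply, smul_apply, ContinuousLinearMap.smulRight_apply,
      ContinuousLinearMap.comp_apply, map_add, map_smul]
    module
  add {Y Y'} hY hY' := by
    have h1 : (fun q ↦ S.phi q ((Y + Y') q)) =
        (fun q ↦ S.phi q (Y q)) + fun q ↦ S.phi q (Y' q) := by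
      funext q; simp
    have hc := (leviCivita S.g).isCovariantDerivativeOnUniv
    rw [h1, hc.add (S.mdifferentiableAt_phi hY) (S.mdifferentiableAt_phi hY'), hc.add hY hY']
    ext x
    simp only [sub_apply, add_apply, ContinuousLinearMap.comp_apply, map_add]
    abel

/-- The tensor `∇φ`: `S.phiDeriv p y x` is `(∇_x φ)y`. -/
noncomputable def phiDeriv (p : M) : TangentSpace (𝓡 (2 * n + 1)) p →L[ℝ]
    TangentSpace (𝓡 (2 * n + 1)) p →L[ℝ] TangentSpace (𝓡 (2 * n + 1)) p :=
  TensorialAt.mkHom _ p (S.tensorialAt_phiDeriv p)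

theorem phiDeriv_apply {Y : Π p : M, TangentSpace (𝓡 (2 * n + 1)) p} {p : M}
    (hY : VectorFieldMDiffAt Y p) (x : TangentSpace (𝓡 (2 * n + 1)) p) :
    S.phiDeriv p (Y p) x =
      leviCivita S.g (fun q ↦ S.phi q (Y q)) p x - S.phi p (leviCivita S.g Y p x) := by
  have h := TensorialAt.mkHom_apply (S.tensorialAt_phiDeriv p) hY
  rw [phiDeriv, h]
  rfl

theorem structureTensor_eq (p : M) (x y z : TangentSpace (𝓡 (2 * n + 1)) p) :
    S.structureTensor p x y z = S.g.inner p (S.phiDeriv p y x) z := rfl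

theorem leviCivita_phi {Y : Π p : M, TangentSpace (𝓡 (2 * n + 1)) p} {p : M}
    (hY : VectorFieldMDiffAt Y p) (x : TangentSpace (𝓡 (2 * n + 1)) p) :
    leviCivita S.g (fun q ↦ S.phi q (Y q)) p x =
      S.phi p (leviCivita S.g Y p x) + S.phiDeriv p (Y p) x := by
  rw [S.phiDeriv_apply hY]
  abel

/-- `∇φ` is selfadjoint because `φ` is. -/
theorem inner_phiDeriv_symm (p : M) (x y z : TangentSpace (𝓡 (2 * n + 1)) p) :
    S.g.inner p (S.phiDeriv p y x) z = S.g.inner p (S.phiDeriv p z x) y := by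
  have hL := isLeviCivita_leviCivita S.g
  have hy := FiberBundle.mdifferentiableAt_extend (𝓡 (2 * n + 1))
    (EuclideanSpace ℝ (Fin (2 * n + 1))) y
  have hz := FiberBundle.mdifferentiableAt_extend (𝓡 (2 * n + 1))
    (EuclideanSpace ℝ (Fin (2 * n + 1))) z
  have h1 := hL.metric x hz (S.mdifferentiableAt_phi hy)
  have h2 := hL.metric x hy (S.mdifferentiableAt_phi hz)
  simp only [S.g_phi_symm _ (FiberBundle.extend (EuclideanSpace ℝ (Fin (2 * n + 1))) z _)] at h1
  rw [h1, S.leviCivita_phi hy, S.leviCivita_phi hz] at h2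
  simp only [FiberBundle.extend_apply_self, map_add] at h2
  rw [S.g_phi_symm p _ y, S.g_phi_symm p _ z] at h2
  linear_combination h2 + S.g.symm p (S.phiDeriv p y x) z - S.g.symm p (S.phiDeriv p z x) y

theorem eta_leviCivita_xi (p : M) (x : TangentSpace (𝓡 (2 * n + 1)) p) :
    S.eta p (leviCivita S.g S.xi p x) = 0 := by
  have h := (isLeviCivita_leviCivita S.g).metric x (S.mdifferentiableAt_xi p)
    (S.mdifferentiableAt_xi p)
  simp only [S.g_xi, S.eta_xi, mvfderiv_const, S.g.symm p (S.xi p)] at h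
  simp at h
  linarith

theorem phiDeriv_xi (p : M) (x : TangentSpace (𝓡 (2 * n + 1)) p) :
    S.phiDeriv p (S.xi p) x = - S.phi p (leviCivita S.g S.xi p x) := by
  rw [S.phiDeriv_apply (S.mdifferentiableAt_xi p)]
  have h : (fun q ↦ S.phi q (S.xi q)) = 0 := by
    funext q; exact S.phi_xi q
  rw [h]
  simp

variable {S}

/-- On a para-Sasaki-like manifold `(∇_x φ)y = -g(x, y)ξ - η(y)x + 2η(x)η(y)ξ`: the values of `F` on
horizontal vectors and on `ξ` determine it completely, by the symmetry of `F` in its last two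
arguments. -/
theorem IsParaSasakiLike.phiDeriv_eq (hS : S.IsParaSasakiLike) (p : M)
    (x y : TangentSpace (𝓡 (2 * n + 1)) p) :
    S.phiDeriv p y x = - (S.g.inner p x y) • S.xi p - S.eta p y • x
      + (2 * S.eta p x * S.eta p y) • S.xi p := by
  refine metric_nondegenerate S.g fun z ↦ ?_
  have hdec : ∀ v : TangentSpace (𝓡 (2 * n + 1)) p, ∃ v', S.eta p v' = 0 ∧
      v = v' + S.eta p v • S.xi p := fun v ↦
    ⟨v - S.eta p v • S.xi p, by simp [S.eta_xi], by abel⟩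
  -- Each vector is split into a horizontal part and a multiple of `ξ`.
  obtain ⟨x', hx, hx'⟩ := hdec x
  obtain ⟨y', hy, hy'⟩ := hdec y
  obtain ⟨z', hz, hz'⟩ := hdec z
  generalize S.eta p x = a at *
  generalize S.eta p y = b at *
  generalize S.eta p z = c at *
  subst hx' hy' hz'
  have hF : ∀ X Y Z, S.eta p X = 0 → S.eta p Y = 0 → S.eta p Z = 0 → _ :=
    fun X Y Z ↦ hS p X Y Z
  simp only [structureTensor_eq] at hF
  obtain ⟨h1, h2, h3, h4⟩ := hF x' y' z' hx hy hz
  obtain ⟨-, -, h5, h6⟩ := hF x' z' y' hx hz hy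
  have h7 := S.inner_phiDeriv_symm p (S.xi p) y' (S.xi p)
  have h8 := S.inner_phiDeriv_symm p x' (S.xi p) z'
  have h9 : ∀ v, S.g.inner p (S.phiDeriv p (S.xi p) v) (S.xi p) = 0 := fun v ↦ by
    rw [S.g_xi, S.phiDeriv_xi, map_neg, S.eta_phi, neg_zero]
  have e1 : ∀ v, S.g.inner p (S.xi p) v = S.eta p v := fun v ↦ by rw [S.g.symm, S.g_xi]
  simp only [map_add, map_smul, map_sub, map_neg, add_apply, smul_apply, sub_apply, neg_apply,
    smul_eq_mul, h1, h2, h3, h4, h5, h6, h7, h8, h9, e1, S.g_xi, hx, hy, hz, S.eta_xi, neg_smul]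
  ring

/-- On a para-Sasaki-like manifold `∇_x ξ = φ x`. -/
theorem IsParaSasakiLike.leviCivita_xi (hS : S.IsParaSasakiLike) (p : M)
    (x : TangentSpace (𝓡 (2 * n + 1)) p) : leviCivita S.g S.xi p x = S.phi p x := by
  have h1 := S.phiDeriv_xi p x
  rw [hS.phiDeriv_eq, S.g_xi, S.eta_xi] at h1
  have h2 : S.phi p (leviCivita S.g S.xi p x) = x - S.eta p x • S.xi p := by
    rw [← neg_eq_iff_eq_neg.2 h1]
    module
  have h3 := S.phi_phi p (leviCivita S.g S.xi p x)
  rw [h2, S.eta_leviCivita_xi, map_sub, map_smul, S.phi_xi] at h3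
  simpa using h3.symm

variable (S)

/-- The family of bilinear forms `a g(x, y) + b g(x, φ y) + c η(x)η(y)`, which contains both the
transformed metric and the difference of the two Levi-Civita connections. -/
noncomputable def bilin (a b c : ℝ) (p : M) (x y : TangentSpace (𝓡 (2 * n + 1)) p) : ℝ :=
  a * S.g.inner p x y + b * S.g.inner p x (S.phi p y) + c * (S.eta p x * S.eta p y)

theorem bilin_symm (a b c : ℝ) (p : M) (x y : TangentSpace (𝓡 (2 * n + 1)) p) :
    S.bilin a b c p x y = S.bilin a b c p y x := by
  rw [bilin, bilin, S.g.symm p x y, S.g_phi_symm p x y, mul_comm (S.eta p x)]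

theorem mdifferentiableAt_eta {Y : Π p : M, TangentSpace (𝓡 (2 * n + 1)) p} {p : M}
    (hY : VectorFieldMDiffAt Y p) : MDifferentiableAt (𝓡 (2 * n + 1)) 𝓘(ℝ) (fun q ↦ S.eta q (Y q)) p := by
  simp only [← S.g_xi]
  exact mdiffAt_inner S.g hY (S.mdifferentiableAt_xi p)

theorem mdifferentiableAt_bilin (a b c : ℝ) {Y Z : Π p : M, TangentSpace (𝓡 (2 * n + 1)) p} {p : M}
    (hY : VectorFieldMDiffAt Y p) (hZ : VectorFieldMDiffAt Z p) :
    MDifferentiableAt (𝓡 (2 * n + 1)) 𝓘(ℝ) (fun q ↦ S.bilin a b c q (Y q) (Z q)) p :=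
  ((mdifferentiableAt_const.mul (mdiffAt_inner S.g hY hZ)).add
    (mdifferentiableAt_const.mul (mdiffAt_inner S.g hY (S.mdifferentiableAt_phi hZ)))).add
    (mdifferentiableAt_const.mul ((S.mdifferentiableAt_eta hY).mul (S.mdifferentiableAt_eta hZ)))

variable {S}

theorem IsParaSasakiLike.mvfderiv_eta (hS : S.IsParaSasakiLike)
    {Y : Π p : M, TangentSpace (𝓡 (2 * n + 1)) p} {p : M} (hY : VectorFieldMDiffAt Y p)
    (x : TangentSpace (𝓡 (2 * n + 1)) p) :
    mvfderiv (𝓡 (2 * n + 1)) (fun q ↦ S.eta q (Y q)) p x =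
      S.eta p (leviCivita S.g Y p x) + S.g.inner p (Y p) (S.phi p x) := by
  simp only [← S.g_xi]
  rw [(isLeviCivita_leviCivita S.g).metric x hY (S.mdifferentiableAt_xi p), hS.leviCivita_xi]

/-- The derivative of `bilin a b c` along fields, with the explicit covariant derivative of the form in
the last two lines. -/
theorem IsParaSasakiLike.mvfderiv_bilin (hS : S.IsParaSasakiLike) (a b c : ℝ)
    {Y Z : Π p : M, TangentSpace (𝓡 (2 * n + 1)) p} {p : M}
    (hY : VectorFieldMDiffAt Y p) (hZ : VectorFieldMDiffAt Z p) (x : TangentSpace (𝓡 (2 * n + 1)) p) :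
    mvfderiv (𝓡 (2 * n + 1)) (fun q ↦ S.bilin a b c q (Y q) (Z q)) p x =
      S.bilin a b c p (leviCivita S.g Y p x) (Z p) + S.bilin a b c p (Y p) (leviCivita S.g Z p x)
        + b * (- (S.g.inner p x (Y p)) * S.eta p (Z p) - S.g.inner p x (Z p) * S.eta p (Y p)
          + 2 * S.eta p x * S.eta p (Y p) * S.eta p (Z p))
        + c * (S.g.inner p x (S.phi p (Y p)) * S.eta p (Z p)
          + S.eta p (Y p) * S.g.inner p x (S.phi p (Z p))) := by
  have hL := isLeviCivita_leviCivita S.g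
  have hφ := S.mdifferentiableAt_phi hZ
  have h1 := mdiffAt_inner S.g hY hZ
  have h2 := mdiffAt_inner S.g hY hφ
  have h3 := S.mdifferentiableAt_eta hY
  have h4 := S.mdifferentiableAt_eta hZ
  have hc (k : ℝ) {f : M → ℝ} (hf : MDifferentiableAt (𝓡 (2 * n + 1)) 𝓘(ℝ) f p) :
      mvfderiv (𝓡 (2 * n + 1)) (fun q ↦ k * f q) p x = k * mvfderiv (𝓡 (2 * n + 1)) f p x := by
    have h : (fun q ↦ k * f q) = (fun _ ↦ k) * f := rfl
    rw [h, mvfderiv_mul mdifferentiableAt_const hf, mvfderiv_const]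
    simp
  have m {k : ℝ} {f : M → ℝ} (hf : MDifferentiableAt (𝓡 (2 * n + 1)) 𝓘(ℝ) f p) :
      MDifferentiableAt (𝓡 (2 * n + 1)) 𝓘(ℝ) (fun q ↦ k * f q) p :=
    mdifferentiableAt_const.mul hf
  have hb : (fun q ↦ S.bilin a b c q (Y q) (Z q)) =
      (fun q ↦ a * S.g.inner q (Y q) (Z q)) + (fun q ↦ b * S.g.inner q (Y q) (S.phi q (Z q)))
        + fun q ↦ c * ((fun q ↦ S.eta q (Y q)) * fun q ↦ S.eta q (Z q)) q := rfl
  simp only [bilin] at hb ⊢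
  rw [hb, mvfderiv_add ((m h1).add (m h2)) (m (h3.mul h4)), mvfderiv_add (m h1) (m h2),
    add_apply, add_apply, hc a h1, hc b h2, hc c (h3.mul h4), hL.metric _ hY hZ, hL.metric _ hY hφ]
  rw [mvfderiv_mul h3 h4, S.leviCivita_phi hZ, hS.phiDeriv_eq]
  simp only [add_apply, smul_apply, smul_eq_mul, hS.mvfderiv_eta hY, hS.mvfderiv_eta hZ, map_add,
    map_sub, map_smul, S.g_xi]
  rw [S.g_phi_symm p x (Y p), S.g_phi_symm p x (Z p), S.g.symm p (Y p) x]
  ring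

variable (S)

/-! ### The Levi-Civita connection of the transformed metric -/

theorem bilin_add_left (a b c : ℝ) (p : M) (x x' y : TangentSpace (𝓡 (2 * n + 1)) p) :
    S.bilin a b c p (x + x') y = S.bilin a b c p x y + S.bilin a b c p x' y := by
  simp only [bilin, map_add, add_apply]
  ring

theorem bilin_sub_left (a b c : ℝ) (p : M) (x x' y : TangentSpace (𝓡 (2 * n + 1)) p) :
    S.bilin a b c p (x - x') y = S.bilin a b c p x y - S.bilin a b c p x' y := by
  simp only [bilin, map_sub, sub_apply]
  ring

theorem bilin_smul_left (a b c k : ℝ) (p : M) (x y : TangentSpace (𝓡 (2 * n + 1)) p) :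
    S.bilin a b c p (k • x) y = k * S.bilin a b c p x y := by
  simp only [bilin, map_smul, smul_apply, smul_eq_mul]
  ring

theorem g_xi_left (p : M) (y : TangentSpace (𝓡 (2 * n + 1)) p) :
    S.g.inner p (S.xi p) y = S.eta p y := by
  rw [S.g.symm, S.g_xi]

theorem bilin_xi_left (a b c : ℝ) (p : M) (y : TangentSpace (𝓡 (2 * n + 1)) p) :
    S.bilin a b c p (S.xi p) y = (a + c) * S.eta p y := by
  rw [bilin, g_xi_left, g_xi_left, S.eta_phi, S.eta_xi]
  ring

/-- The coefficient `1 - a / c` of `g(x, φ y)` in the difference of the two Levi-Civita connections, where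
`a = e^{2u} cosh(2v)` and `c = e^{2w}`. -/
noncomputable def homothetyAlpha (u v w : ℝ) : ℝ :=
  1 - Real.exp (2 * u) * Real.cosh (2 * v) / Real.exp (2 * w)

/-- The coefficient `-b / c` of `g(φ x, φ y)` in the difference of the two Levi-Civita connections, where
`b = e^{2u} sinh(2v)` and `c = e^{2w}`. -/
noncomputable def homothetyBeta (u v w : ℝ) : ℝ :=
  - (Real.exp (2 * u) * Real.sinh (2 * v) / Real.exp (2 * w))

/-- The scalar part of the difference of the Levi-Civita connections of the transformed and of the
original metric, `α g(x, φ y) + β g(φ x, φ y)` with `g(φ x, φ y)` written as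
`g(x, y) - η(x)η(y)`; the difference itself is this form times `ξ`. -/
noncomputable def homothetyDiff (u v w : ℝ) (p : M) (x y : TangentSpace (𝓡 (2 * n + 1)) p) : ℝ :=
  S.bilin (homothetyBeta u v w) (homothetyAlpha u v w) (- homothetyBeta u v w) p x y

theorem inner_paracontactHomothety (u v w : ℝ) (p : M) (x y : TangentSpace (𝓡 (2 * n + 1)) p) :
    (S.paracontactHomothety u v w).g.inner p x y =
      S.bilin (Real.exp (2 * u) * Real.cosh (2 * v)) (Real.exp (2 * u) * Real.sinh (2 * v))
        (Real.exp (2 * w) - Real.exp (2 * u) * Real.cosh (2 * v)) p x y :=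
  S.homotheticForm_apply u v w p x y

variable {S}

/-- The transformation changes the Levi-Civita connection by a multiple of `ξ`. -/
theorem IsParaSasakiLike.leviCivita_paracontactHomothety (hS : S.IsParaSasakiLike) (u v w : ℝ)
    {Y : Π p : M, TangentSpace (𝓡 (2 * n + 1)) p} {p : M} (hY : VectorFieldMDiffAt Y p)
    (x : TangentSpace (𝓡 (2 * n + 1)) p) :
    leviCivita (S.paracontactHomothety u v w).g Y p x =
      leviCivita S.g Y p x + S.homothetyDiff u v w p x (Y p) • S.xi p := by
  refine metric_nondegenerate (S.paracontactHomothety u v w).g fun z ↦ ?_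
  have hL := isLeviCivita_leviCivita S.g
  obtain ⟨X, hX, rfl⟩ : ∃ X : Π p : M, TangentSpace (𝓡 (2 * n + 1)) p,
      VectorFieldMDiffAt X p ∧ X p = x :=
    ⟨_, FiberBundle.mdifferentiableAt_extend _ _ x, FiberBundle.extend_apply_self _ _⟩
  obtain ⟨Z, hZ, rfl⟩ : ∃ Z : Π p : M, TangentSpace (𝓡 (2 * n + 1)) p,
      VectorFieldMDiffAt Z p ∧ Z p = z :=
    ⟨_, FiberBundle.mdifferentiableAt_extend _ _ z, FiberBundle.extend_apply_self _ _⟩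
  have h1 := (isLeviCivita_leviCivita
    (S.paracontactHomothety u v w).g).two_mul_inner_eq_koszul hX hY hZ
  simp only [koszul, inner_paracontactHomothety] at h1 ⊢
  have hc : Real.exp (2 * w) ≠ 0 := (Real.exp_pos _).ne'
  have hα : homothetyAlpha u v w =
    1 - Real.exp (2 * u) * Real.cosh (2 * v) / Real.exp (2 * w) := rfl
  have hβ : homothetyBeta u v w =
    - (Real.exp (2 * u) * Real.sinh (2 * v) / Real.exp (2 * w)) := rfl
  rw [homothetyDiff]
  generalize Real.exp (2 * u) * Real.cosh (2 * v) = a at *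
  generalize Real.exp (2 * u) * Real.sinh (2 * v) = b at *
  generalize Real.exp (2 * w) = c at *
  rw [hS.mvfderiv_bilin _ _ _ hY hZ, hS.mvfderiv_bilin _ _ _ hZ hX, hS.mvfderiv_bilin _ _ _ hX hY,
    ← hL.torsion_free hX hY, ← hL.torsion_free hZ hX, ← hL.torsion_free hZ hY] at h1
  rw [bilin_add_left, bilin_smul_left, bilin_xi_left]
  simp only [bilin_sub_left] at h1
  -- All derivatives are moved to the left argument, so that they cancel as atoms.
  rw [S.bilin_symm _ _ _ p (Y p), S.bilin_symm _ _ _ p (Z p),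
    S.bilin_symm _ _ _ p (X p) (leviCivita S.g Y p (Z p)), S.g_phi_symm p (Y p) (X p),
    S.g_phi_symm p (Z p) (X p), S.g_phi_symm p (Z p) (Y p),
    S.g.symm p (Y p) (X p), S.g.symm p (Z p) (X p), S.g.symm p (Z p) (Y p)] at h1
  have hd : c * S.bilin (homothetyBeta u v w) (homothetyAlpha u v w) (-homothetyBeta u v w)
      p (X p) (Y p) = - b * (S.g.inner p (X p) (Y p) - S.eta p (X p) * S.eta p (Y p))
        + (c - a) * S.g.inner p (X p) (S.phi p (Y p)) := by
    rw [bilin, hα, hβ]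
    field_simp
    ring
  linear_combination h1 / 2 - S.eta p (Z p) * hd

/-! ### The curvature of the transformed metric -/

/-- The second covariant derivative `∇'_x ∇'_V Z` for the transformed metric, in terms of `∇`. -/
theorem IsParaSasakiLike.leviCivita_leviCivita_paracontactHomothety (hS : S.IsParaSasakiLike)
    (u v w : ℝ) {V Z : Π p : M, TangentSpace (𝓡 (2 * n + 1)) p} {p : M}
    (hV : ContMDiffAt (𝓡 (2 * n + 1)) (𝓡 (2 * n + 1)).tangent 2 (T% V) p)
    (hZ : ContMDiffAt (𝓡 (2 * n + 1)) (𝓡 (2 * n + 1)).tangent 2 (T% Z) p)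
    (x : TangentSpace (𝓡 (2 * n + 1)) p) :
    leviCivita (S.paracontactHomothety u v w).g
        (fun q ↦ leviCivita (S.paracontactHomothety u v w).g Z q (V q)) p x =
      leviCivita S.g (fun q ↦ leviCivita S.g Z q (V q)) p x
        + S.homothetyDiff u v w p (V p) (Z p) • S.phi p x
        + (S.homothetyDiff u v w p (leviCivita S.g V p x) (Z p)
          + S.homothetyDiff u v w p (V p) (leviCivita S.g Z p x)
          + S.homothetyDiff u v w p x (leviCivita S.g Z p (V p))
          + homothetyAlpha u v w * (- (S.g.inner p x (V p)) * S.eta p (Z p)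
            - S.g.inner p x (Z p) * S.eta p (V p)
            + 2 * S.eta p x * S.eta p (V p) * S.eta p (Z p))
          - homothetyBeta u v w * (S.g.inner p x (S.phi p (V p)) * S.eta p (Z p)
            + S.eta p (V p) * S.g.inner p x (S.phi p (Z p)))) • S.xi p := by
  have hL := isLeviCivita_leviCivita S.g
  have hV1 : VectorFieldMDiffAt V p := hV.mdifferentiableAt two_ne_zero
  have hZ1 : VectorFieldMDiffAt Z p := hZ.mdifferentiableAt two_ne_zero
  have hVZ := hL.mdifferentiableAt hV hZ
  have hA := S.mdifferentiableAt_bilin (homothetyBeta u v w) (homothetyAlpha u v w)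
    (- homothetyBeta u v w) hV1 hZ1
  have hξ := S.mdifferentiableAt_xi p
  have hAξ := hA.smul_section hξ
  have hW := mdifferentiableAt_add_section hVZ hAξ
  have heq : ((fun q ↦ leviCivita S.g Z q (V q)) + (fun q ↦ S.bilin (homothetyBeta u v w)
      (homothetyAlpha u v w) (- homothetyBeta u v w) q (V q) (Z q)) • S.xi :
        Π p : M, TangentSpace (𝓡 (2 * n + 1)) p) =ᶠ[𝓝 p]
      fun q ↦ leviCivita (S.paracontactHomothety u v w).g Z q (V q) := by
    filter_upwards [eventually_mdifferentiableAt hZ] with q hq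
    exact (hS.leviCivita_paracontactHomothety u v w hq _).symm
  have hc := (leviCivita S.g).isCovariantDerivativeOnUniv
  rw [← cov_congr hW heq, hS.leviCivita_paracontactHomothety u v w hW, hc.add hVZ hAξ,
    hc.leibniz hξ hA]
  simp only [add_apply, smul_apply, ContinuousLinearMap.smulRight_apply, hS.leviCivita_xi,
    hS.mvfderiv_bilin _ _ _ hV1 hZ1, Pi.add_apply, Pi.smul_apply']
  have h0 : S.homothetyDiff u v w p x (leviCivita S.g Z p (V p) + S.bilin (homothetyBeta u v w)
      (homothetyAlpha u v w) (- homothetyBeta u v w) p (V p) (Z p) • S.xi p) =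
      S.homothetyDiff u v w p x (leviCivita S.g Z p (V p)) := by
    -- The form vanishes on `ξ`, so there is no contribution quadratic in the difference.
    rw [homothetyDiff, S.bilin_symm, bilin_add_left, bilin_smul_left, bilin_xi_left,
      add_neg_cancel, zero_mul, mul_zero, add_zero, S.bilin_symm]
    rfl
  rw [h0]
  simp only [homothetyDiff]
  module

/-- The curvature of the transformed metric. The derivatives of the extended fields cancel because `∇`
is torsion free. -/
theorem IsParaSasakiLike.curvature_paracontactHomothety (hS : S.IsParaSasakiLike) (u v w : ℝ)
    (p : M) (x y z : TangentSpace (𝓡 (2 * n + 1)) p) :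
    curvature (S.paracontactHomothety u v w).g p x y z =
      curvature S.g p x y z + S.homothetyDiff u v w p y z • S.phi p x
        - S.homothetyDiff u v w p x z • S.phi p y
        + (homothetyAlpha u v w * (S.eta p x * S.g.inner p y z - S.eta p y * S.g.inner p x z)
          + homothetyBeta u v w * (S.eta p x * S.g.inner p y (S.phi p z)
            - S.eta p y * S.g.inner p x (S.phi p z))) • S.xi p := by
  have hL := isLeviCivita_leviCivita S.g
  rw [curvature_eq_curvatureOn, curvature_eq_curvatureOn]
  obtain ⟨X, hX, hXx, hX'⟩ : ∃ X : Π p : M, TangentSpace (𝓡 (2 * n + 1)) p,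
      ContMDiffAt (𝓡 (2 * n + 1)) (𝓡 (2 * n + 1)).tangent 2 (T% X) p ∧ X p = x ∧
      FiberBundle.extend (EuclideanSpace ℝ (Fin (2 * n + 1))) x = X :=
    ⟨_, contMDiffAt_two_extend x, FiberBundle.extend_apply_self _ _, rfl⟩
  obtain ⟨Y, hY, hYy, hY'⟩ : ∃ Y : Π p : M, TangentSpace (𝓡 (2 * n + 1)) p,
      ContMDiffAt (𝓡 (2 * n + 1)) (𝓡 (2 * n + 1)).tangent 2 (T% Y) p ∧ Y p = y ∧
      FiberBundle.extend (EuclideanSpace ℝ (Fin (2 * n + 1))) y = Y :=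
    ⟨_, contMDiffAt_two_extend y, FiberBundle.extend_apply_self _ _, rfl⟩
  obtain ⟨Z, hZ, hZz, hZ'⟩ : ∃ Z : Π p : M, TangentSpace (𝓡 (2 * n + 1)) p,
      ContMDiffAt (𝓡 (2 * n + 1)) (𝓡 (2 * n + 1)).tangent 2 (T% Z) p ∧ Z p = z ∧
      FiberBundle.extend (EuclideanSpace ℝ (Fin (2 * n + 1))) z = Z :=
    ⟨_, contMDiffAt_two_extend z, FiberBundle.extend_apply_self _ _, rfl⟩
  rw [hX', hY', hZ']
  have hZ1 : VectorFieldMDiffAt Z p := hZ.mdifferentiableAt two_ne_zero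
  have ht := hL.torsion_free (hX.mdifferentiableAt two_ne_zero) (hY.mdifferentiableAt two_ne_zero)
  simp only [curvatureOn]
  rw [hS.leviCivita_leviCivita_paracontactHomothety u v w hY hZ,
    hS.leviCivita_leviCivita_paracontactHomothety u v w hX hZ,
    hS.leviCivita_paracontactHomothety u v w hZ1, ← ht]
  subst hXx hYy hZz
  have h1 : S.homothetyDiff u v w p (leviCivita S.g Y p (X p) - leviCivita S.g X p (Y p)) (Z p) =
      S.homothetyDiff u v w p (leviCivita S.g Y p (X p)) (Z p)
        - S.homothetyDiff u v w p (leviCivita S.g X p (Y p)) (Z p) := S.bilin_sub_left ..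
  rw [h1, S.g.symm p (Y p) (X p), S.g_phi_symm p (Y p) (X p)]
  module

/-- On a para-Sasaki-like manifold `R(x, y)ξ = η(x)y - η(y)x`. -/
theorem IsParaSasakiLike.curvature_xi (hS : S.IsParaSasakiLike) (p : M)
    (x y : TangentSpace (𝓡 (2 * n + 1)) p) :
    curvature S.g p x y (S.xi p) = S.eta p x • y - S.eta p y • x := by
  have hL := isLeviCivita_leviCivita S.g
  have hx := contMDiffAt_two_extend x
  have hy := contMDiffAt_two_extend y
  have hξ : ContMDiffAt (𝓡 (2 * n + 1)) (𝓡 (2 * n + 1)).tangent 2 (T% S.xi) p :=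
    S.contMDiff_xi.contMDiffAt.of_le ENat.LEInfty.out
  rw [curvature_eq_curvatureOn, curvatureOn_eq_of_apply_eq hL hx hy (contMDiffAt_two_extend _) hξ
    (FiberBundle.extend_apply_self _ _)]
  have hx1 := hx.mdifferentiableAt two_ne_zero
  have hy1 := hy.mdifferentiableAt two_ne_zero
  simp only [curvatureOn, hS.leviCivita_xi]
  rw [S.leviCivita_phi hx1, S.leviCivita_phi hy1, hS.phiDeriv_eq, hS.phiDeriv_eq,
    ← hL.torsion_free hx1 hy1, map_sub]
  simp only [FiberBundle.extend_apply_self]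
  rw [S.g.symm p y x]
  module

variable (S)

theorem finrank_tangentSpace (p : M) : finrank ℝ (TangentSpace (𝓡 (2 * n + 1)) p) = 2 * n + 1 :=
  finrank_euclideanSpace_fin (𝕜 := ℝ) (n := 2 * n + 1)

/-- The trace of `φ` vanishes: `φ` is the difference of the projections `(φ² + φ) / 2` and
`(φ² - φ) / 2` onto its eigenspaces in `ker η`, which both have dimension `n`. -/
theorem trace_phi (p : M) : LinearMap.trace ℝ _ (S.phi p).toLinearMap = 0 := by
  have : FiniteDimensional ℝ (TangentSpace (𝓡 (2 * n + 1)) p) :=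
    inferInstanceAs (FiniteDimensional ℝ (EuclideanSpace ℝ (Fin (2 * n + 1))))
  let f := (S.phi p).toLinearMap
  have h3 : ∀ x, S.phi p (S.phi p (S.phi p x)) = S.phi p x := fun x ↦ by
    rw [S.phi_phi, S.eta_phi, zero_smul, sub_zero]
  have key : ∀ s : ℝ, s * s = 1 → LinearMap.IsProj
      (Module.End.eigenspace f s ⊓ LinearMap.ker (S.eta p).toLinearMap)
      ((2⁻¹ : ℝ) • (f ∘ₗ f + s • f)) := by
    intro s hs
    constructor
    · intro x
      rw [Submodule.mem_inf, Module.End.mem_eigenspace_iff, LinearMap.mem_ker]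
      constructor
      · simp only [f, LinearMap.smul_apply, LinearMap.add_apply, LinearMap.comp_apply,
          ContinuousLinearMap.coe_coe, map_smul, map_add, h3]
        rw [smul_comm s, smul_add s, smul_smul s s, hs]
        module
      · simp [f, S.eta_phi]
    · intro x hx
      rw [Submodule.mem_inf, Module.End.mem_eigenspace_iff, LinearMap.mem_ker] at hx
      simp only [LinearMap.smul_apply, LinearMap.add_apply, LinearMap.comp_apply, hx.1, map_smul,
        smul_smul, hs]
      module
  have h1 := (key 1 (by norm_num)).trace
  have h2 := (key (-1) (by norm_num)).trace
  rw [S.finrank_pos] at h1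
  rw [S.finrank_neg] at h2
  have h4 : f = (2⁻¹ : ℝ) • (f ∘ₗ f + (1 : ℝ) • f) - (2⁻¹ : ℝ) • (f ∘ₗ f + (-1 : ℝ) • f) := by
    module
  change LinearMap.trace ℝ _ f = 0
  rw [h4, map_sub, h1, h2, sub_self]

variable {S}

theorem IsParaSasakiLike.ricci_xi_xi (hS : S.IsParaSasakiLike) (p : M) :
    ricci S.g p (S.xi p) (S.xi p) = - (2 * n) := by
  have : FiniteDimensional ℝ (TangentSpace (𝓡 (2 * n + 1)) p) :=
    inferInstanceAs (FiniteDimensional ℝ (EuclideanSpace ℝ (Fin (2 * n + 1))))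
  have h : curvatureEnd S.g p (S.xi p) (S.xi p) =
      (S.eta p).toLinearMap.smulRight (S.xi p) - LinearMap.id := by
    ext x
    simp [curvatureEnd_apply, hS.curvature_xi, S.eta_xi]
  rw [ricci_eq_trace, h, map_sub, LinearMap.trace_smulRight, LinearMap.trace_id,
    finrank_tangentSpace]
  simp [S.eta_xi]

/-- The Ricci tensor is invariant: the term `A(y, z)φ x` of the curvature is traceless, and the
traces of the other two corrections cancel. -/
theorem IsParaSasakiLike.ricci_paracontactHomothety (hS : S.IsParaSasakiLike) (u v w : ℝ) (p : M)
    (y z : TangentSpace (𝓡 (2 * n + 1)) p) :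
    ricci (S.paracontactHomothety u v w).g p y z = ricci S.g p y z := by
  have : FiniteDimensional ℝ (TangentSpace (𝓡 (2 * n + 1)) p) :=
    inferInstanceAs (FiniteDimensional ℝ (EuclideanSpace ℝ (Fin (2 * n + 1))))
  -- `A` and `B` are the functionals `x ↦ A(x, z)` and `x ↦ B(x, y, z)`.
  let A : TangentSpace (𝓡 (2 * n + 1)) p →ₗ[ℝ] ℝ :=
    homothetyBeta u v w • (S.g.inner p z).toLinearMap
      + homothetyAlpha u v w • (S.g.inner p (S.phi p z)).toLinearMap
      - (homothetyBeta u v w * S.eta p z) • (S.eta p).toLinearMap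
  let B : TangentSpace (𝓡 (2 * n + 1)) p →ₗ[ℝ] ℝ :=
    (homothetyAlpha u v w * S.g.inner p y z + homothetyBeta u v w * S.g.inner p y (S.phi p z)) •
        (S.eta p).toLinearMap
      - (homothetyAlpha u v w * S.eta p y) • (S.g.inner p z).toLinearMap
      - (homothetyBeta u v w * S.eta p y) • (S.g.inner p (S.phi p z)).toLinearMap
  have h : curvatureEnd (S.paracontactHomothety u v w).g p y z =
      curvatureEnd S.g p y z + S.homothetyDiff u v w p y z • (S.phi p).toLinearMap
        - A.smulRight (S.phi p y) + B.smulRight (S.xi p) := by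
    ext x
    rw [curvatureEnd_apply, hS.curvature_paracontactHomothety]
    have hA : A x = S.homothetyDiff u v w p x z := by
      simp only [A, homothetyDiff, bilin, LinearMap.sub_apply, LinearMap.add_apply,
        LinearMap.smul_apply, ContinuousLinearMap.coe_coe, smul_eq_mul]
      rw [S.g.symm p z x, S.g.symm p (S.phi p z) x]
      ring
    have hB : B x = homothetyAlpha u v w *
          (S.eta p x * S.g.inner p y z - S.eta p y * S.g.inner p x z)
        + homothetyBeta u v w * (S.eta p x * S.g.inner p y (S.phi p z)
          - S.eta p y * S.g.inner p x (S.phi p z)) := by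
      simp only [B, LinearMap.sub_apply, LinearMap.smul_apply, ContinuousLinearMap.coe_coe,
        smul_eq_mul]
      rw [S.g.symm p z x, S.g.symm p (S.phi p z) x]
      ring
    simp only [LinearMap.add_apply, LinearMap.sub_apply, LinearMap.smul_apply,
      LinearMap.smulRight_apply, ContinuousLinearMap.coe_coe, curvatureEnd_apply, hA, hB]
  rw [ricci_eq_trace, ricci_eq_trace, h]
  simp only [map_add, map_sub, map_smul, LinearMap.trace_smulRight, S.trace_phi]
  simp only [A, B, LinearMap.add_apply, LinearMap.sub_apply, LinearMap.smul_apply,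
    ContinuousLinearMap.coe_coe, smul_eq_mul, S.eta_phi, S.eta_xi, S.g_xi, S.g_phi_phi]
  rw [S.g.symm p z (S.phi p y), S.g.symm p (S.phi p y) z, S.g_phi_symm p z y, S.g.symm p z y]
  ring

variable (S)

theorem scal_eq_trace {p : M}
    {L : TangentSpace (𝓡 (2 * n + 1)) p →ₗ[ℝ] TangentSpace (𝓡 (2 * n + 1)) p}
    (hL : ∀ x y, S.g.inner p (L x) y = ricci S.g p x y) :
    scal S.g p = LinearMap.trace ℝ _ L := by
  rw [trace_eq_sum_inner S.g _ (orthonormalBasis_inner S.g p) L]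
  simp only [hL, scal]

/-- `Scal* = tr (φ L)` if `L` represents the Ricci tensor. As `φ` is selfadjoint, no symmetry of the
Ricci tensor is needed. -/
theorem scalStar_eq_trace {p : M}
    {L : TangentSpace (𝓡 (2 * n + 1)) p →ₗ[ℝ] TangentSpace (𝓡 (2 * n + 1)) p}
    (hL : ∀ x y, S.g.inner p (L x) y = ricci S.g p x y) :
    S.scalStar p = LinearMap.trace ℝ _ ((S.phi p).toLinearMap ∘ₗ L) := by
  rw [trace_eq_sum_inner S.g _ (orthonormalBasis_inner S.g p)]
  refine Finset.sum_congr rfl fun i _ ↦ ?_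
  rw [← hL, S.g_phi_symm, S.g.symm]
  rfl

/-- The endomorphism `K` with `g(x, y) = g'(K x, y)` for the transformed metric `g'`. -/
noncomputable def homothetyEnd (u v w : ℝ) (p : M) :
    TangentSpace (𝓡 (2 * n + 1)) p →ₗ[ℝ] TangentSpace (𝓡 (2 * n + 1)) p :=
  (Real.exp (-2 * u) * Real.cosh (2 * v)) • LinearMap.id
    - (Real.exp (-2 * u) * Real.sinh (2 * v)) • (S.phi p).toLinearMap
    + (Real.exp (-2 * w) - Real.exp (-2 * u) * Real.cosh (2 * v)) •
      (S.eta p).toLinearMap.smulRight (S.xi p)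

theorem inner_homothetyEnd (u v w : ℝ) (p : M) (x y : TangentSpace (𝓡 (2 * n + 1)) p) :
    (S.paracontactHomothety u v w).g.inner p (S.homothetyEnd u v w p x) y = S.g.inner p x y := by
  rw [inner_paracontactHomothety]
  simp only [homothetyEnd, LinearMap.add_apply, LinearMap.sub_apply, LinearMap.smul_apply,
    LinearMap.smulRight_apply, LinearMap.id_apply, ContinuousLinearMap.coe_coe, bilin_add_left,
    bilin_sub_left, bilin_smul_left, bilin_xi_left]
  simp only [bilin, S.g_phi_phi, S.eta_phi]
  rw [S.g.symm p (S.phi p x) y, S.g_phi_symm p x y]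
  have h1 : Real.exp (-2 * u) * Real.exp (2 * u) = 1 := by rw [← Real.exp_add]; simp
  have h2 : Real.exp (-2 * w) * Real.exp (2 * w) = 1 := by rw [← Real.exp_add]; simp
  have h3 := Real.cosh_sq_sub_sinh_sq (2 * v)
  linear_combination (S.g.inner p x y - S.eta p x * S.eta p y) *
      (Real.exp (-2 * u) * Real.exp (2 * u) * h3 + h1) + S.eta p x * S.eta p y * h2

theorem trace_smulRight_comp (p : M)
    (L : TangentSpace (𝓡 (2 * n + 1)) p →ₗ[ℝ] TangentSpace (𝓡 (2 * n + 1)) p) :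
    LinearMap.trace ℝ _ ((S.eta p).toLinearMap.smulRight (S.xi p) ∘ₗ L) =
      S.eta p (L (S.xi p)) := by
  have : FiniteDimensional ℝ (TangentSpace (𝓡 (2 * n + 1)) p) :=
    inferInstanceAs (FiniteDimensional ℝ (EuclideanSpace ℝ (Fin (2 * n + 1))))
  have h : (S.eta p).toLinearMap.smulRight (S.xi p) ∘ₗ L =
    ((S.eta p).toLinearMap ∘ₗ L).smulRight (S.xi p) := rfl
  rw [h, LinearMap.trace_smulRight]
  rfl

variable {S}

/-- If `L` represents the Ricci tensor for the original metric, then `K ∘ L` represents it for the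
transformed metric. -/
theorem IsParaSasakiLike.exists_ricciEnd (hS : S.IsParaSasakiLike) (u v w : ℝ) (p : M) :
    ∃ L : TangentSpace (𝓡 (2 * n + 1)) p →ₗ[ℝ] TangentSpace (𝓡 (2 * n + 1)) p,
      (∀ x y, S.g.inner p (L x) y = ricci S.g p x y) ∧
      (∀ x y, (S.paracontactHomothety u v w).g.inner p ((S.homothetyEnd u v w p ∘ₗ L) x) y =
        ricci (S.paracontactHomothety u v w).g p x y) ∧
      S.eta p (L (S.xi p)) = - (2 * n) := by
  obtain ⟨L, hL⟩ := exists_inner_eq S.g (ricciForm S.g p)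
  refine ⟨L, hL, fun x y ↦ ?_, ?_⟩
  · rw [hS.ricci_paracontactHomothety, LinearMap.comp_apply, S.inner_homothetyEnd, hL]
    rfl
  · rw [← S.g_xi, hL, ricciForm_apply, hS.ricci_xi_xi]

theorem IsParaSasakiLike.scal_paracontactHomothety (hS : S.IsParaSasakiLike) (u v w : ℝ) (p : M) :
    scal (S.paracontactHomothety u v w).g p =
      Real.exp (-2 * u) * Real.cosh (2 * v) * scal S.g p
        - Real.exp (-2 * u) * Real.sinh (2 * v) * S.scalStar p
        - 2 * n * (Real.exp (-2 * w) - Real.exp (-2 * u) * Real.cosh (2 * v)) := by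
  obtain ⟨L, h1, h2, h3⟩ := hS.exists_ricciEnd u v w p
  rw [scal_eq_trace _ h2, S.scal_eq_trace h1, S.scalStar_eq_trace h1]
  simp only [homothetyEnd, LinearMap.add_comp, LinearMap.sub_comp, LinearMap.smul_comp,
    LinearMap.id_comp, map_add, map_sub, map_smul, S.trace_smulRight_comp, h3, smul_eq_mul]
  ring

theorem IsParaSasakiLike.scalStar_paracontactHomothety (hS : S.IsParaSasakiLike) (u v w : ℝ)
    (p : M) :
    (S.paracontactHomothety u v w).scalStar p =
      Real.exp (-2 * u) * Real.cosh (2 * v) * S.scalStar p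
        - Real.exp (-2 * u) * Real.sinh (2 * v) * (scal S.g p + 2 * n) := by
  obtain ⟨L, h1, h2, h3⟩ := hS.exists_ricciEnd u v w p
  have h4 : (S.phi p).toLinearMap ∘ₗ S.homothetyEnd u v w p ∘ₗ L =
      (Real.exp (-2 * u) * Real.cosh (2 * v)) • ((S.phi p).toLinearMap ∘ₗ L)
        - (Real.exp (-2 * u) * Real.sinh (2 * v)) •
          (L - (S.eta p).toLinearMap.smulRight (S.xi p) ∘ₗ L) := by
    ext x
    simp [homothetyEnd, S.phi_phi, S.phi_xi]
  rw [scalStar_eq_trace _ h2, S.scal_eq_trace h1, S.scalStar_eq_trace h1]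
  change LinearMap.trace ℝ _ ((S.phi p).toLinearMap ∘ₗ S.homothetyEnd u v w p ∘ₗ L) = _
  rw [h4]
  simp only [map_sub, map_smul, S.trace_smulRight_comp, h3, smul_eq_mul]
  ring

end AlmostParacontactParacomplexRiemannian

end ParaSasaki

theorem proposition4p3 (n : ℕ) {M : Type*} [TopologicalSpace M]
    [ChartedSpace (EuclideanSpace ℝ (Fin (2 * n + 1))) M] [IsManifold (𝓡 (2 * n + 1)) ∞ M]
    (S : ParaSasaki.AlmostParacontactParacomplexRiemannian n M) (hS : S.IsParaSasakiLike)
    (u v w : ℝ) :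
    (∀ (p : M) (x y : TangentSpace (𝓡 (2 * n + 1)) p),
      ParaSasaki.ricci (S.paracontactHomothety u v w).g p x y = ParaSasaki.ricci S.g p x y) ∧
    (∀ p : M, ParaSasaki.scal (S.paracontactHomothety u v w).g p =
      Real.exp (-2 * u) * Real.cosh (2 * v) * ParaSasaki.scal S.g p
        - Real.exp (-2 * u) * Real.sinh (2 * v) * S.scalStar p
        - 2 * n * (Real.exp (-2 * w) - Real.exp (-2 * u) * Real.cosh (2 * v))) ∧
    (∀ p : M, (S.paracontactHomothety u v w).scalStar p =
      Real.exp (-2 * u) * Real.cosh (2 * v) * S.scalStar p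
        - Real.exp (-2 * u) * Real.sinh (2 * v) * (ParaSasaki.scal S.g p + 2 * n)) := by
  exact ⟨hS.ricci_paracontactHomothety u v w, hS.scal_paracontactHomothety u v w,
    hS.scalStar_paracontactHomothety u v w⟩
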